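/- Let $\mathcal H$ be a complex Hilbert space and let $\mathcal F_{\mathcal H}=\mathbb C\oplus\mathcal H\oplus(\mathcal H\wedge\mathcal H)\oplus\cdots$ be the fermion Fock space over $\mathcal H$, with vacuum vector $\Omega$, creators $a^\dagger_h$, annihilators $a_h$ ($h\in\mathcal H$) and number operator $N=\sum_j a^\dagger_{e_j}a_{e_j}$, where $(e_j)$ is any orthonormal basis of $\mathcal H$. For a density operator $\Delta$ on $\mathcal F_{\mathcal H}$, let $\gamma_\Delta$ be the operator on $\mathcal H$ with $\langle h,\gamma_\Delta g\rangle=\mathrm{Tr}(\Delta a^\dagger_g a_h)$ for all $g,h\in\mathcal H$, and let $S(\Delta)=-\mathrm{Tr}(\Delta\log\Delta)\in[0,\infty]$. Let $\Delta$ be a density operator on $\mathcal F_{\mathcal H}$ with $\Delta N=N\Delta$ and $\mathrm{Tr}(\Delta N)<\infty$. Then $\mathcal H$ has an orthonormal basis consisting of eigenvectors of $\gamma_\Delta$. Let $(f_j)_{j\in J}$ be any such basis, indexed by a totally ordered set $J$, with $\gamma_\Delta f_j=p_jf_j$, and suppose that $$-\sum_j p_j\log p_j-\sum_j(1-p_j)\log(1-p_j)<\infty$$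 (with $0\log 0=0$). Let $$\Gamma_{\gamma_\Delta}=\sum_{\mathbf s}p(\mathbf s)\,|a^\dagger_{\mathbf s}\Omega\rangle\langle a^\dagger_{\mathbf s}\Omega|,\qquad p(\mathbf s)=\prod_{i\in\mathbf s}p_i\prod_{j\notin\mathbf s}(1-p_j),$$ be the free state associated with $\gamma_\Delta$; here $\mathbf s$ ranges over the finite subsets of $J$, and $a^\dagger_{\mathbf s}=a^\dagger_{f_{s_n}}\cdots a^\dagger_{f_{s_1}}$ for $\mathbf s=\{s_1<\cdots<s_n\}$. Then $$S(\Delta)\ \le\ -\sum_j p_j\log p_j-\sum_j(1-p_j)\log(1-p_j),$$ with equality if and only if $\Delta=\Gamma_{\gamma_\Delta}$. Moreover, $\Gamma_{\gamma_\Delta}$ is a density operator that commutes with $N$ and has finite expected particle number, its one-particle operator is $\gamma_\Delta$, and $S(\Delta')\le S(\Gamma_{\gamma_\Delta})$ for every density operator $\Delta'$ on $\mathcal F_{\mathcal H}$ with $\gamma_{\Delta'}=\gamma_\Delta$: the free state maximizes the entropy among all states with a given one-particle operator. -/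

import Mathlib

open scoped ENNReal ComplexConjugate

universe u v

noncomputable section

/-! ### The exterior algebra as a pre-Hilbert space -/

namespace PreFock

variable {H : Type u} [NormedAddCommGroup H] [InnerProductSpace ℂ H]

/-- Contraction `a_h` with `⟨h, ·⟩` on the exterior algebra: the antiderivation with
`a_h 1 = 0` and `a_h (g ∧ x) = ⟨h, g⟩ x - g ∧ a_h x`. -/
def contr (h : H) : ExteriorAlgebra ℂ H →ₗ[ℂ] ExteriorAlgebra ℂ H :=
  CliffordAlgebra.contractLeft (Q := (0 : QuadraticForm ℂ H)) (innerₛₗ ℂ h)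

theorem contr_one (h : H) : contr h (1 : ExteriorAlgebra ℂ H) = 0 :=
  CliffordAlgebra.contractLeft_one _ _

theorem contr_ι_mul (h g : H) (x : ExteriorAlgebra ℂ H) :
    contr h (ExteriorAlgebra.ι ℂ g * x)
      = inner ℂ h g • x - ExteriorAlgebra.ι ℂ g * contr h x :=
  CliffordAlgebra.contractLeft_ι_mul _ _ _

theorem contr_contr (h : H) (x : ExteriorAlgebra ℂ H) : contr h (contr h x) = 0 :=
  CliffordAlgebra.contractLeft_contractLeft _ _

theorem contr_add (g h : H) (x : ExteriorAlgebra ℂ H) :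
    contr (g + h) x = contr g x + contr h x := by
  simp [contr]

theorem contr_smul (c : ℂ) (h : H) (x : ExteriorAlgebra ℂ H) :
    contr (c • h) x = conj c • contr h x := by
  simp [contr]

/-- Precomposition with `a_h` on antilinear functionals; it is linear in `h`. -/
def dualContr : H →ₗ[ℂ] Module.End ℂ (ExteriorAlgebra ℂ H →ₗ⋆[ℂ] ℂ) where
  toFun h :=
    { toFun := fun φ => φ.comp (contr h)
      map_add' := fun _ _ => rfl
      map_smul' := fun _ _ => rfl }
  map_add' g h := by
    ext φ x
    simp [contr_add]
  map_smul' c h := by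
    ext φ x
    simp [contr_smul]

theorem dualContr_sq (h : H) :
    (dualContr h * dualContr h : Module.End ℂ (ExteriorAlgebra ℂ H →ₗ⋆[ℂ] ℂ)) = 0 := by
  refine LinearMap.ext fun φ => LinearMap.ext fun x => ?_
  change φ (contr h (contr h x)) = 0
  rw [contr_contr, map_zero]

/-- The conjugate of the degree-zero component. -/
def vacuumForm : ExteriorAlgebra ℂ H →ₗ⋆[ℂ] ℂ where
  toFun x := conj (ExteriorAlgebra.algebraMapInv x)
  map_add' x y := by simp
  map_smul' c x := by simp

/-- The inner product on the exterior algebra (conjugate-linear on the left), determined by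
`⟨1, y⟩ =` degree-zero component of `y`, and `⟨h ∧ x, y⟩ = ⟨x, a_h y⟩`. Equivalently, different
degrees are orthogonal and `⟨g₁ ∧ ⋯ ∧ gₙ, h₁ ∧ ⋯ ∧ hₙ⟩ = det (⟨gᵢ, hⱼ⟩)`. -/
def form (x y : ExteriorAlgebra ℂ H) : ℂ :=
  conj (ExteriorAlgebra.lift ℂ ⟨dualContr, dualContr_sq⟩ x vacuumForm y)

theorem form_add_left (x x' y : ExteriorAlgebra ℂ H) :
    form (x + x') y = form x y + form x' y := by
  simp [form]

theorem form_smul_left (c : ℂ) (x y : ExteriorAlgebra ℂ H) :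
    form (c • x) y = conj c * form x y := by
  simp [form]

theorem form_add_right (x y y' : ExteriorAlgebra ℂ H) :
    form x (y + y') = form x y + form x y' := by
  simp [form]

theorem form_smul_right (c : ℂ) (x y : ExteriorAlgebra ℂ H) :
    form x (c • y) = c * form x y := by
  simp [form]

theorem form_one_left (y : ExteriorAlgebra ℂ H) :
    form 1 y = ExteriorAlgebra.algebraMapInv y := by
  simp [form, vacuumForm]

theorem form_ι_mul_left (h : H) (x y : ExteriorAlgebra ℂ H) :
    form (ExteriorAlgebra.ι ℂ h * x) y = form x (contr h y) := by
  simp [form, dualContr]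

theorem form_zero_right (x : ExteriorAlgebra ℂ H) : form x 0 = 0 := by
  simp [form]

theorem form_zero_left (x : ExteriorAlgebra ℂ H) : form 0 x = 0 := by
  simp [form]

theorem form_sub_right (x y y' : ExteriorAlgebra ℂ H) :
    form x (y - y') = form x y - form x y' := by
  simp [form]

theorem form_sub_left (x x' y : ExteriorAlgebra ℂ H) :
    form (x - x') y = form x y - form x' y := by
  simp [form]

/-- Induction on exterior products. -/
theorem ext_induction {C : ExteriorAlgebra ℂ H → Prop} (h1 : C 1)
    (hadd : ∀ x y, C x → C y → C (x + y)) (hsmul : ∀ (c : ℂ) x, C x → C (c • x))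
    (hmul : ∀ h x, C x → C (ExteriorAlgebra.ι ℂ h * x)) (x : ExteriorAlgebra ℂ H) : C x := by
  induction x using CliffordAlgebra.left_induction with
  | algebraMap r =>
    rw [Algebra.algebraMap_eq_smul_one]
    exact hsmul r _ h1
  | add x y hx hy => exact hadd x y hx hy
  | ι_mul x m hx => exact hmul m x hx

theorem form_ι_mul_right (h : H) (x y : ExteriorAlgebra ℂ H) :
    form x (ExteriorAlgebra.ι ℂ h * y) = form (contr h x) y := by
  induction x using ext_induction generalizing y with
  | h1 =>
    rw [form_one_left, contr_one, form_zero_left, map_mul]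
    simp [ExteriorAlgebra.algebraMapInv]
  | hadd x x' hx hx' => simp only [form_add_left, hx, hx', map_add]
  | hsmul c x hx => simp only [form_smul_left, hx, map_smul]
  | hmul g x hx =>
    rw [form_ι_mul_left, contr_ι_mul, contr_ι_mul, form_sub_right, form_sub_left, form_smul_left,
      form_smul_right, hx, form_ι_mul_left, inner_conj_symm]

theorem form_one_right (x : ExteriorAlgebra ℂ H) :
    form x 1 = conj (ExteriorAlgebra.algebraMapInv x) := by
  induction x using ext_induction with
  | h1 => simp [form_one_left]
  | hadd x y hx hy => simp [form_add_left, hx, hy]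
  | hsmul c x hx => simp [form_smul_left, hx]
  | hmul h x hx =>
    rw [form_ι_mul_left, contr_one, form_zero_right, map_mul]
    simp [ExteriorAlgebra.algebraMapInv]

theorem form_conj_symm (x y : ExteriorAlgebra ℂ H) : conj (form y x) = form x y := by
  induction x using ext_induction generalizing y with
  | h1 => rw [form_one_right, form_one_left, Complex.conj_conj]
  | hadd x x' hx hx' => simp only [form_add_left, form_add_right, map_add, hx, hx']
  | hsmul c x hx => simp only [form_smul_left, form_smul_right, map_mul, hx]
  | hmul g x hx => rw [form_ι_mul_right, form_ι_mul_left, hx]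

/-- Every element lies in the subalgebra generated by a finite orthonormal set of vectors. -/
theorem exists_orthonormal (x : ExteriorAlgebra ℂ H) :
    ∃ s : Finset H, Orthonormal ℂ (fun v : (s : Set H) => (v : H)) ∧
      x ∈ Algebra.adjoin ℂ (ExteriorAlgebra.ι ℂ '' (s : Set H)) := by
  classical
  have key : ∃ t : Finset H, x ∈ Algebra.adjoin ℂ (ExteriorAlgebra.ι ℂ '' (t : Set H)) := by
    induction x using ext_induction with
    | h1 => exact ⟨∅, one_mem _⟩
    | hadd x y hx hy =>
      obtain ⟨t, ht⟩ := hx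
      obtain ⟨t', ht'⟩ := hy
      refine ⟨t ∪ t', add_mem (Algebra.adjoin_mono ?_ ht) (Algebra.adjoin_mono ?_ ht')⟩
      · exact Set.image_mono (by simp)
      · exact Set.image_mono (by simp)
    | hsmul c x hx =>
      obtain ⟨t, ht⟩ := hx
      exact ⟨t, Subalgebra.smul_mem _ ht c⟩
    | hmul h x hx =>
      obtain ⟨t, ht⟩ := hx
      refine ⟨insert h t, mul_mem (Algebra.subset_adjoin ⟨h, by simp, rfl⟩)
        (Algebra.adjoin_mono (Set.image_mono (by simp)) ht)⟩
  obtain ⟨t, ht⟩ := key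
  let V : Submodule ℂ H := Submodule.span ℂ (t : Set H)
  have : FiniteDimensional ℂ V := FiniteDimensional.span_finset ℂ t
  let b := stdOrthonormalBasis ℂ V
  have hb : Orthonormal ℂ (fun i => (b i : H)) := b.orthonormal.comp_linearIsometry V.subtypeₗᵢ
  refine ⟨Finset.univ.image fun i => (b i : H), ?_, ?_⟩
  · have hset : ((Finset.univ.image fun i => (b i : H) : Finset H) : Set H)
        = Set.range fun i => (b i : H) := by simp
    rw [hset]
    exact hb.toSubtypeRange
  · refine (Algebra.adjoin_le ?_ : _ ≤ _) ht
    rintro _ ⟨v, hv, rfl⟩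
    have hsum := congrArg (Subtype.val) (b.sum_repr ⟨v, Submodule.subset_span hv⟩)
    simp only [AddSubmonoidClass.coe_finsetSum, Submodule.coe_smul] at hsum
    rw [← hsum, map_sum]
    refine sum_mem fun i _ => ?_
    rw [map_smul]
    exact Subalgebra.smul_mem _ (Algebra.subset_adjoin (Set.mem_image_of_mem _ (by simp))) _

theorem contr_eq_zero (s : Set H) (e : H) (he : ∀ v ∈ s, inner ℂ e v = 0)
    {x : ExteriorAlgebra ℂ H} (hx : x ∈ Algebra.adjoin ℂ (ExteriorAlgebra.ι ℂ '' s)) :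
    contr e x = 0 := by
  have hgen : ∀ z, contr e z = 0 → ∀ v ∈ s, contr e (ExteriorAlgebra.ι ℂ v * z) = 0 := by
    intro z hz v hv
    rw [contr_ι_mul, he v hv, hz]
    simp
  suffices h : ∀ y, contr e y = 0 → contr e (x * y) = 0 by simpa using h 1 (contr_one e)
  induction hx using Algebra.adjoin_induction with
  | mem x hx =>
    obtain ⟨v, hv, rfl⟩ := hx
    exact fun y hy => hgen y hy v hv
  | algebraMap r =>
    intro y hy
    rw [← Algebra.smul_def, map_smul, hy, smul_zero]
  | add x x' _ _ hx hx' =>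
    intro y hy
    rw [add_mul, map_add, hx y hy, hx' y hy, add_zero]
  | mul x x' _ _ hx hx' =>
    intro y hy
    rw [mul_assoc]
    exact hx _ (hx' y hy)

theorem adjoin_insert_decomp (s : Set H) (e : H) {x : ExteriorAlgebra ℂ H}
    (hx : x ∈ Algebra.adjoin ℂ (ExteriorAlgebra.ι ℂ '' (insert e s))) :
    ∃ y ∈ Algebra.adjoin ℂ (ExteriorAlgebra.ι ℂ '' s),
      ∃ z ∈ Algebra.adjoin ℂ (ExteriorAlgebra.ι ℂ '' s), x = ExteriorAlgebra.ι ℂ e * y + z := by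
  let A := Algebra.adjoin ℂ (ExteriorAlgebra.ι ℂ '' s)
  suffices h : ∀ w, (∃ y ∈ A, ∃ z ∈ A, w = ExteriorAlgebra.ι ℂ e * y + z) →
      ∃ y ∈ A, ∃ z ∈ A, x * w = ExteriorAlgebra.ι ℂ e * y + z by
    simpa using h 1 ⟨0, zero_mem _, 1, one_mem _, by simp⟩
  induction hx using Algebra.adjoin_induction with
  | mem x hx =>
    obtain ⟨v, hv, rfl⟩ := hx
    rintro _ ⟨y, hy, z, hz, rfl⟩
    rcases hv with rfl | hv
    · refine ⟨z, hz, 0, zero_mem _, ?_⟩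
      rw [mul_add, ← mul_assoc, ExteriorAlgebra.ι_sq_zero]
      simp
    · have hvA : ExteriorAlgebra.ι ℂ v ∈ A := Algebra.subset_adjoin ⟨v, hv, rfl⟩
      refine ⟨-(ExteriorAlgebra.ι ℂ v * y), neg_mem (mul_mem hvA hy),
        ExteriorAlgebra.ι ℂ v * z, mul_mem hvA hz, ?_⟩
      have hsw := eq_neg_of_add_eq_zero_left (ExteriorAlgebra.ι_add_mul_swap (R := ℂ) v e)
      rw [mul_add, ← mul_assoc, hsw, neg_mul, mul_neg, mul_assoc]
  | algebraMap r =>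
    rintro _ ⟨y, hy, z, hz, rfl⟩
    refine ⟨r • y, Subalgebra.smul_mem _ hy r, r • z, Subalgebra.smul_mem _ hz r, ?_⟩
    rw [← Algebra.smul_def, smul_add, mul_smul_comm]
  | add x x' _ _ hx hx' =>
    intro w hw
    obtain ⟨y, hy, z, hz, h⟩ := hx w hw
    obtain ⟨y', hy', z', hz', h'⟩ := hx' w hw
    refine ⟨y + y', add_mem hy hy', z + z', add_mem hz hz', ?_⟩
    rw [add_mul, h, h', mul_add]
    abel
  | mul x x' _ _ hx hx' =>
    intro w hw
    rw [mul_assoc]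
    exact hx _ (hx' w hw)

theorem form_self_nonneg_aux [DecidableEq H] (s : Finset H) :
    Orthonormal ℂ (fun v : (s : Set H) => (v : H)) →
    ∀ x ∈ Algebra.adjoin ℂ (ExteriorAlgebra.ι ℂ '' (s : Set H)), 0 ≤ (form x x).re := by
  induction s using Finset.induction_on with
  | empty =>
    intro _ x hx
    simp only [Finset.coe_empty, Set.image_empty, Algebra.adjoin_empty] at hx
    obtain ⟨r, rfl⟩ := Algebra.mem_bot.1 hx
    rw [Algebra.algebraMap_eq_smul_one, form_smul_left, form_smul_right, form_one_left, map_one,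
      mul_one, mul_comm, Complex.mul_conj]
    exact_mod_cast Complex.normSq_nonneg r
  | insert e s hes ih =>
    intro ho x hx
    rw [Finset.coe_insert] at hx
    have ho' : Orthonormal ℂ (fun v : (s : Set H) => (v : H)) :=
      ho.comp (Set.inclusion (by simp)) (Set.inclusion_injective _)
    have horth : ∀ v ∈ (s : Set H), inner ℂ e v = 0 := by
      intro v hv
      have hne : e ≠ v := by
        rintro rfl
        exact hes hv
      exact ho.2 (i := ⟨e, by simp⟩) (j := ⟨v, by simpa using Or.inr hv⟩) (by simpa using hne)
    have hee : inner ℂ e e = (1 : ℂ) := by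
      have := ho.1 ⟨e, by simp⟩
      rw [inner_self_eq_norm_sq_to_K]
      simp only at this
      rw [this]
      simp
    obtain ⟨y, hy, z, hz, rfl⟩ := adjoin_insert_decomp _ _ hx
    have hcy := contr_eq_zero _ e horth hy
    have hcz := contr_eq_zero _ e horth hz
    have h1 : form (ExteriorAlgebra.ι ℂ e * y) (ExteriorAlgebra.ι ℂ e * y) = form y y := by
      rw [form_ι_mul_left, contr_ι_mul, hcy, hee]
      simp
    have h2 : form (ExteriorAlgebra.ι ℂ e * y) z = 0 := by
      rw [form_ι_mul_left, hcz, form_zero_right]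
    have h3 : form z (ExteriorAlgebra.ι ℂ e * y) = 0 := by
      rw [form_ι_mul_right, hcz, form_zero_left]
    rw [form_add_left, form_add_right, form_add_right, h1, h2, h3]
    simpa using add_nonneg (ih ho' y hy) (ih ho' z hz)

theorem form_self_nonneg (x : ExteriorAlgebra ℂ H) : 0 ≤ (form x x).re := by
  classical
  obtain ⟨s, hs, hx⟩ := exists_orthonormal x
  exact form_self_nonneg_aux s hs x hx

end PreFock

/-- The exterior algebra `ℂ ⊕ H ⊕ (H ∧ H) ⊕ ⋯` (algebraic sum), as a pre-Hilbert space. -/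
def FockAlg (H : Type u) [NormedAddCommGroup H] [InnerProductSpace ℂ H] : Type u :=
  ExteriorAlgebra ℂ H

namespace FockAlg

variable {H : Type u} [NormedAddCommGroup H] [InnerProductSpace ℂ H]

instance : AddCommGroup (FockAlg H) := inferInstanceAs (AddCommGroup (ExteriorAlgebra ℂ H))
instance : Module ℂ (FockAlg H) := inferInstanceAs (Module ℂ (ExteriorAlgebra ℂ H))

instance : PreInnerProductSpace.Core ℂ (FockAlg H) where
  inner x y := PreFock.form (H := H) x y
  conj_inner_symm x y := PreFock.form_conj_symm (H := H) x y
  re_inner_nonneg x := PreFock.form_self_nonneg (H := H) x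
  add_left x y z := PreFock.form_add_left (H := H) x y z
  smul_left x y c := PreFock.form_smul_left (H := H) c x y

instance : SeminormedAddCommGroup (FockAlg H) :=
  InnerProductSpace.Core.toSeminormedAddCommGroup (𝕜 := ℂ)

instance : InnerProductSpace ℂ (FockAlg H) := InnerProductSpace.ofCore _

/-- The unit `1` of the exterior algebra. -/
def one : FockAlg H := (1 : ExteriorAlgebra ℂ H)

end FockAlg

/-- Fermion Fock space over `H`: the Hilbert space completion of the exterior algebra. -/
def Fock (H : Type u) [NormedAddCommGroup H] [InnerProductSpace ℂ H] : Type u :=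
  UniformSpace.Completion (FockAlg H)

namespace Fock

variable {H : Type u} [NormedAddCommGroup H] [InnerProductSpace ℂ H]

instance : NormedAddCommGroup (Fock H) :=
  inferInstanceAs (NormedAddCommGroup (UniformSpace.Completion (FockAlg H)))

instance : InnerProductSpace ℂ (Fock H) :=
  inferInstanceAs (InnerProductSpace ℂ (UniformSpace.Completion (FockAlg H)))

instance : CompleteSpace (Fock H) :=
  inferInstanceAs (CompleteSpace (UniformSpace.Completion (FockAlg H)))

/-- The isometric embedding of the exterior algebra into Fock space. -/
def incl : FockAlg H →ₗᵢ[ℂ] Fock H :=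
  UniformSpace.Completion.toComplₗᵢ (𝕜 := ℂ) (E := FockAlg H)

theorem denseRange_incl : DenseRange (incl (H := H)) :=
  UniformSpace.Completion.denseRange_coe (α := FockAlg H)

/-- Left exterior multiplication `x ↦ h ∧ x` on the exterior algebra. -/
def wedge : H →ₗ[ℂ] FockAlg H →ₗ[ℂ] FockAlg H :=
  (LinearMap.mul ℂ (ExteriorAlgebra ℂ H)).comp (ExteriorAlgebra.ι ℂ)

theorem norm_wedge_le (h : H) (x : FockAlg H) : ‖wedge h x‖ ≤ ‖h‖ * ‖x‖ := by
  have h0 : ∀ y : FockAlg H, ‖y‖ ^ 2 = (PreFock.form (H := H) y y).re := fun y =>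
    norm_sq_eq_re_inner (𝕜 := ℂ) y
  refine le_of_sq_le_sq ?_ (by positivity)
  have h1 : PreFock.form (H := H) (wedge h x) (wedge h x)
      = inner ℂ h h * PreFock.form (H := H) x x
        - PreFock.form (PreFock.contr h x) (PreFock.contr h x) := by
    let x' : ExteriorAlgebra ℂ H := x
    change PreFock.form (ExteriorAlgebra.ι ℂ h * x') (ExteriorAlgebra.ι ℂ h * x') = _
    rw [PreFock.form_ι_mul_left, PreFock.contr_ι_mul, PreFock.form_sub_right,
      PreFock.form_smul_right, PreFock.form_ι_mul_right]
  have h2 := PreFock.form_self_nonneg (PreFock.contr h x)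
  rw [h0, h1, mul_pow, h0 x, inner_self_eq_norm_sq_to_K]
  have h3 : ((‖h‖ : ℂ) ^ 2 * PreFock.form (H := H) x x).re
      = ‖h‖ ^ 2 * (PreFock.form (H := H) x x).re := by
    rw [← Complex.ofReal_pow, Complex.re_ofReal_mul]
  simp only [Complex.sub_re, Complex.coe_algebraMap]
  rw [h3]
  linarith

/-- The creator `a†_h`: the bounded extension of `x ↦ h ∧ x` to Fock space. -/
def create (h : H) : Fock H →L[ℂ] Fock H :=
  (incl.toContinuousLinearMap ∘L (wedge h).mkContinuous ‖h‖ (norm_wedge_le h)).extend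
    (incl (H := H)).toContinuousLinearMap

/-- The annihilator `a_h`, the adjoint of the creator. -/
def annihilate (h : H) : Fock H →L[ℂ] Fock H :=
  ContinuousLinearMap.adjoint (create h)

/-- The vacuum vector `Ω = 1 ⊕ 0 ⊕ 0 ⊕ ⋯`. -/
def vacuum (H : Type u) [NormedAddCommGroup H] [InnerProductSpace ℂ H] : Fock H :=
  incl FockAlg.one

theorem create_incl (h : H) (x : FockAlg H) : create h (incl x) = incl (wedge h x) :=
  ContinuousLinearMap.extend_eq _ (e := (incl (H := H)).toContinuousLinearMap) denseRange_incl
    (UniformSpace.Completion.isUniformInducing_coe (FockAlg H)) x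

theorem eq_of_incl {A B : Fock H →L[ℂ] Fock H} (h : ∀ x, A (incl x) = B (incl x)) : A = B :=
  ContinuousLinearMap.coeFn_injective
    (denseRange_incl.equalizer A.continuous B.continuous (funext h))

theorem create_add (g h : H) : create (g + h) = create g + create h := by
  refine eq_of_incl fun x => ?_
  simp only [add_apply, create_incl, map_add, LinearMap.add_apply]

theorem create_smul (c : ℂ) (h : H) : create (c • h) = c • create h := by
  refine eq_of_incl fun x => ?_
  simp only [smul_apply, create_incl, map_smul, LinearMap.smul_apply]

theorem norm_create_le (h : H) : ‖create h‖ ≤ ‖h‖ := by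
  refine ContinuousLinearMap.opNorm_le_bound _ (norm_nonneg _) fun ψ => ?_
  refine denseRange_incl.induction_on ψ
    (isClosed_le (create h).continuous.norm (continuous_const.mul continuous_norm)) fun x => ?_
  rw [create_incl, LinearIsometry.norm_map, LinearIsometry.norm_map]
  exact norm_wedge_le h x

end Fock

/-! ### Traces and density operators -/

section Trace

variable (E : Type u) [NormedAddCommGroup E] [InnerProductSpace ℂ E] [CompleteSpace E]

/-- The index set of a chosen Hilbert basis. -/
def basisSet : Set E := (exists_hilbertBasis ℂ E).choose

/-- A chosen Hilbert basis. -/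
def chosenBasis : HilbertBasis (basisSet E) ℂ E := (exists_hilbertBasis ℂ E).choose_spec.choose

variable {E}

/-- The trace `∑ᵢ ⟨eᵢ, T eᵢ⟩`. It is used only for trace-class `T`, for which it does not depend
on the Hilbert basis. -/
def trace (T : E →L[ℂ] E) : ℂ :=
  ∑' i, inner ℂ (chosenBasis E i) (T (chosenBasis E i))

/-- The trace of a positive operator, with values in `[0, ∞]`. -/
def posTrace (T : E →L[ℂ] E) : ℝ≥0∞ :=
  ∑' i, ENNReal.ofReal (inner ℂ (chosenBasis E i) (T (chosenBasis E i))).re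

variable (E) in
/-- Density operators: positive operators of trace one. -/
structure DensityOperator where
  /-- The underlying bounded operator. -/
  op : E →L[ℂ] E
  isPositive : op.IsPositive
  posTrace_eq_one : posTrace op = 1

namespace DensityOperator

/-- The von Neumann entropy `S(X) = -Tr(X log X)` in `[0, ∞]`: the trace of the positive operator
`η(X)`, where `η(t) = -t log t`. -/
def entropy (X : DensityOperator E) : ℝ≥0∞ :=
  posTrace (cfc Real.negMulLog X.op)

theorem diag_bound (X : DensityOperator E) (A : E →L[ℂ] E) :
    Summable (fun i => inner ℂ (chosenBasis E i) ((X.op ∘L A) (chosenBasis E i))) ∧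
      ‖trace (X.op ∘L A)‖ ≤ ‖A‖ := by
  set e := chosenBasis E with he
  obtain ⟨S, hS⟩ := CStarAlgebra.nonneg_iff_eq_star_mul_self.1
    ((ContinuousLinearMap.nonneg_iff_isPositive _).2 X.isPositive)
  have hS' : ∀ x y, inner ℂ x (X.op y) = inner ℂ (S x) (S y) := by
    intro x y
    rw [hS, ContinuousLinearMap.star_eq_adjoint]
    exact ContinuousLinearMap.adjoint_inner_right S _ _
  have hdiag : ∀ i, (inner ℂ (e i) (X.op (e i))).re = ‖S (e i)‖ ^ 2 := by
    intro i
    rw [hS']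
    exact (norm_sq_eq_re_inner (𝕜 := ℂ) (S (e i))).symm
  have hparseval : ∀ v : E, ∑' i, ENNReal.ofReal (‖inner ℂ (e i) v‖ ^ 2)
      = ENNReal.ofReal (‖v‖ ^ 2) := by
    intro v
    have h := e.hasSum_inner_mul_inner v v
    have h2 : HasSum (fun i => ‖inner ℂ (e i) v‖ ^ 2) (‖v‖ ^ 2) := by
      have h3 := Complex.hasSum_re h
      convert h3 using 1
      · funext i
        rw [← inner_conj_symm v (e i), mul_comm, Complex.mul_conj, Complex.ofReal_re,
          Complex.normSq_eq_norm_sq]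
      · exact norm_sq_eq_re_inner (𝕜 := ℂ) v
    rw [← ENNReal.ofReal_tsum_of_nonneg (fun _ => by positivity) h2.summable, h2.tsum_eq]
  have h1 : ∑' i, ENNReal.ofReal (‖S (e i)‖ ^ 2) = 1 := by
    rw [← X.posTrace_eq_one]
    exact tsum_congr fun i => by rw [← hdiag]
  have h2 : ∑' i, ENNReal.ofReal (‖S (A (e i))‖ ^ 2) ≤ ENNReal.ofReal (‖A‖ ^ 2) := by
    calc ∑' i, ENNReal.ofReal (‖S (A (e i))‖ ^ 2)
        = ∑' i, ∑' j, ENNReal.ofReal (‖inner ℂ (e j) (S (A (e i)))‖ ^ 2) :=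
          tsum_congr fun i => (hparseval _).symm
      _ = ∑' j, ∑' i, ENNReal.ofReal (‖inner ℂ (e j) (S (A (e i)))‖ ^ 2) := ENNReal.tsum_comm
      _ = ∑' j, ENNReal.ofReal
            (‖ContinuousLinearMap.adjoint A (ContinuousLinearMap.adjoint S (e j))‖ ^ 2) := by
          refine tsum_congr fun j => ?_
          rw [← hparseval]
          refine tsum_congr fun i => ?_
          rw [← ContinuousLinearMap.adjoint_inner_left, ← ContinuousLinearMap.adjoint_inner_left,
            norm_inner_symm]
      _ ≤ ∑' j, ENNReal.ofReal (‖A‖ ^ 2)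
            * ENNReal.ofReal (‖ContinuousLinearMap.adjoint S (e j)‖ ^ 2) := by
          refine ENNReal.tsum_le_tsum fun j => ?_
          rw [← ENNReal.ofReal_mul (by positivity), ← mul_pow]
          refine ENNReal.ofReal_le_ofReal (pow_le_pow_left₀ (norm_nonneg _) ?_ 2)
          refine (ContinuousLinearMap.le_opNorm _ _).trans_eq ?_
          rw [LinearIsometryEquiv.norm_map]
      _ = ENNReal.ofReal (‖A‖ ^ 2) := by
          rw [ENNReal.tsum_mul_left]
          have : ∑' j, ENNReal.ofReal (‖ContinuousLinearMap.adjoint S (e j)‖ ^ 2) = 1 := by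
            rw [← h1]
            calc ∑' j, ENNReal.ofReal (‖ContinuousLinearMap.adjoint S (e j)‖ ^ 2)
                = ∑' j, ∑' i, ENNReal.ofReal
                    (‖inner ℂ (e i) (ContinuousLinearMap.adjoint S (e j))‖ ^ 2) :=
                  tsum_congr fun j => (hparseval _).symm
              _ = ∑' i, ∑' j, ENNReal.ofReal
                    (‖inner ℂ (e i) (ContinuousLinearMap.adjoint S (e j))‖ ^ 2) :=
                  ENNReal.tsum_comm
              _ = ∑' i, ENNReal.ofReal (‖S (e i)‖ ^ 2) := by
                  refine tsum_congr fun i => ?_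
                  rw [← hparseval]
                  refine tsum_congr fun j => ?_
                  rw [ContinuousLinearMap.adjoint_inner_right, norm_inner_symm]
          rw [this, mul_one]
  have s1 : HasSum (fun i => ‖S (e i)‖ ^ 2) 1 := by
    have hs : Summable (fun i => ‖S (e i)‖ ^ 2) := by
      have := ENNReal.summable_toReal (h1.trans_ne ENNReal.one_ne_top)
      simpa [ENNReal.toReal_ofReal (sq_nonneg _)] using this
    have := ENNReal.ofReal_tsum_of_nonneg (fun i => sq_nonneg ‖S (e i)‖) hs
    rw [h1, ENNReal.ofReal_eq_one] at this
    rw [← this]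
    exact hs.hasSum
  have s2 : Summable (fun i => ‖S (A (e i))‖ ^ 2) := by
    have := ENNReal.summable_toReal (h2.trans_lt ENNReal.ofReal_lt_top).ne
    simpa [ENNReal.toReal_ofReal (sq_nonneg _)] using this
  have t2 : ∑' i, ‖S (A (e i))‖ ^ 2 ≤ ‖A‖ ^ 2 := by
    rw [← ENNReal.ofReal_le_ofReal_iff (by positivity),
      ENNReal.ofReal_tsum_of_nonneg (fun i => sq_nonneg _) s2]
    exact h2
  have hle : ∀ i, ‖inner ℂ (e i) ((X.op ∘L A) (e i))‖ ≤ ‖S (e i)‖ * ‖S (A (e i))‖ := by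
    intro i
    rw [ContinuousLinearMap.comp_apply, hS']
    exact norm_inner_le_norm _ _
  rcases eq_or_ne A 0 with rfl | hA
  · simp [trace, summable_zero]
  have hA' : 0 < ‖A‖ := norm_pos_iff.2 hA
  have hle' : ∀ i, ‖inner ℂ (e i) ((X.op ∘L A) (e i))‖
      ≤ (‖A‖ * ‖S (e i)‖ ^ 2 + ‖A‖⁻¹ * ‖S (A (e i))‖ ^ 2) / 2 := by
    intro i
    refine (hle i).trans ?_
    have h := sq_nonneg (‖A‖ * ‖S (e i)‖ - ‖S (A (e i))‖)
    have h' : ‖A‖⁻¹ * (‖A‖ * ‖S (e i)‖ - ‖S (A (e i))‖) ^ 2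
        = ‖A‖ * ‖S (e i)‖ ^ 2 - 2 * (‖S (e i)‖ * ‖S (A (e i))‖)
          + ‖A‖⁻¹ * ‖S (A (e i))‖ ^ 2 := by
      field_simp
      ring
    have h'' := mul_nonneg (inv_nonneg.2 hA'.le) h
    linarith
  have hsum : HasSum (fun i => (‖A‖ * ‖S (e i)‖ ^ 2 + ‖A‖⁻¹ * ‖S (A (e i))‖ ^ 2) / 2)
      ((‖A‖ * 1 + ‖A‖⁻¹ * ∑' i, ‖S (A (e i))‖ ^ 2) / 2) :=
    ((s1.mul_left _).add (s2.hasSum.mul_left _)).div_const 2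
  have hn : Summable (fun i => ‖inner ℂ (e i) ((X.op ∘L A) (e i))‖) :=
    Summable.of_nonneg_of_le (fun _ => norm_nonneg _) hle' hsum.summable
  refine ⟨hn.of_norm, ?_⟩
  calc ‖trace (X.op ∘L A)‖ ≤ ∑' i, ‖inner ℂ (e i) ((X.op ∘L A) (e i))‖ := norm_tsum_le_tsum_norm hn
    _ ≤ ∑' i, (‖A‖ * ‖S (e i)‖ ^ 2 + ‖A‖⁻¹ * ‖S (A (e i))‖ ^ 2) / 2 :=
      hn.tsum_le_tsum hle' hsum.summable
    _ = (‖A‖ * 1 + ‖A‖⁻¹ * ∑' i, ‖S (A (e i))‖ ^ 2) / 2 := hsum.tsum_eq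
    _ ≤ (‖A‖ * 1 + ‖A‖⁻¹ * ‖A‖ ^ 2) / 2 := by gcongr
    _ = ‖A‖ := by
      field_simp
      ring

theorem trace_comp_add (X : DensityOperator E) (A B : E →L[ℂ] E) :
    trace (X.op ∘L (A + B)) = trace (X.op ∘L A) + trace (X.op ∘L B) := by
  rw [trace, trace, trace, ← (X.diag_bound A).1.tsum_add (X.diag_bound B).1]
  exact tsum_congr fun i => by simp

theorem trace_comp_smul (X : DensityOperator E) (c : ℂ) (A : E →L[ℂ] E) :
    trace (X.op ∘L (c • A)) = c * trace (X.op ∘L A) := by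
  rw [trace, trace, ← tsum_mul_left]
  exact tsum_congr fun i => by simp

end DensityOperator

end Trace

/-! ### One-particle operators and the class of finite states -/

namespace Fock

variable {H : Type u} [NormedAddCommGroup H] [InnerProductSpace ℂ H]

/-- The sesquilinear form `(h, g) ↦ Tr(Δ a†_g a_h)` on `H`. -/
def oneParticleForm (Δ : DensityOperator (Fock H)) : H →L⋆[ℂ] H →L[ℂ] ℂ :=
  (LinearMap.mk₂'ₛₗ (starRingEnd ℂ) (RingHom.id ℂ)
    (fun h g => trace (Δ.op ∘L (create g ∘L annihilate h)))
    (fun h h' g => by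
      rw [← Δ.trace_comp_add, annihilate, annihilate, annihilate, create_add, map_add,
        ContinuousLinearMap.comp_add])
    (fun c h g => by
      rw [annihilate, annihilate, create_smul, LinearIsometryEquiv.map_smulₛₗ,
        ContinuousLinearMap.comp_smul, Δ.trace_comp_smul, smul_eq_mul])
    (fun h g g' => by
      rw [← Δ.trace_comp_add, create_add, ContinuousLinearMap.add_comp])
    (fun c h g => by
      rw [create_smul, ContinuousLinearMap.smul_comp, Δ.trace_comp_smul, RingHom.id_apply,
        smul_eq_mul])).mkContinuous₂ 1 (fun h g => by
      change ‖trace (Δ.op ∘L (create g ∘L annihilate h))‖ ≤ _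
      refine (Δ.diag_bound _).2.trans ((ContinuousLinearMap.opNorm_comp_le _ _).trans ?_)
      rw [annihilate, LinearIsometryEquiv.norm_map, one_mul, mul_comm]
      exact mul_le_mul (norm_create_le h) (norm_create_le g) (norm_nonneg _) (norm_nonneg _))

variable [CompleteSpace H]

/-- The one-particle statistical operator `γ_Δ`: `⟨h, γ_Δ g⟩ = Tr(Δ a†_g a_h)`. -/
def oneParticle (Δ : DensityOperator (Fock H)) : H →L[ℂ] H :=
  ContinuousLinearMap.adjoint (InnerProductSpace.continuousLinearMapOfBilin (oneParticleForm Δ))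

theorem inner_oneParticle (Δ : DensityOperator (Fock H)) (g h : H) :
    inner ℂ h (oneParticle Δ g) = trace (Δ.op ∘L create g ∘L annihilate h) := by
  rw [oneParticle, ContinuousLinearMap.adjoint_inner_right,
    InnerProductSpace.continuousLinearMapOfBilin_apply]
  rfl

variable (H) in
/-- The number operator `N = ∑ⱼ a†_j a_j` for a Hilbert basis of `H`, an unbounded operator whose
domain consists of the `ψ` for which `∑ⱼ a†_j a_j ψ` converges. -/
def number : Fock H →ₗ.[ℂ] Fock H where
  domain :=
    { carrier := {ψ | Summable fun j =>
        create (chosenBasis H j) (annihilate (chosenBasis H j) ψ)}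
      zero_mem' := by simp [summable_zero]
      add_mem' := fun hφ hψ => by simpa using hφ.add hψ
      smul_mem' := fun c ψ hψ => by simpa using hψ.const_smul c }
  toFun :=
    { toFun := fun ψ => ∑' j, create (chosenBasis H j) (annihilate (chosenBasis H j) ψ)
      map_add' := fun φ ψ => by simpa using φ.2.tsum_add ψ.2
      map_smul' := fun c ψ => by simpa using ψ.2.tsum_const_smul c }

/-- `Δ N = N Δ`: the bounded operator `Δ` preserves the domain of `N` and commutes with `N`
there. -/
def CommutesWithNumber (Δ : DensityOperator (Fock H)) : Prop :=
  ∀ ψ : (number H).domain, ∃ hψ : Δ.op ψ ∈ (number H).domain,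
    number H ⟨Δ.op ψ, hψ⟩ = Δ.op (number H ψ)

/-- The expected particle number `Tr(Δ N) = ∑ⱼ Tr(Δ a†_j a_j)` in `[0, ∞]`. -/
def meanNumber (Δ : DensityOperator (Fock H)) : ℝ≥0∞ :=
  ∑' j, ENNReal.ofReal
    (trace (Δ.op ∘L create (chosenBasis H j) ∘L annihilate (chosenBasis H j))).re

/-- The class of density operators on Fock space that commute with the number operator and have
finite expected particle number. -/
def IsFiniteState (Δ : DensityOperator (Fock H)) : Prop :=
  CommutesWithNumber Δ ∧ meanNumber Δ < ∞

/-! ### Free states -/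

variable {ι : Type v} [LinearOrder ι]

/-- `a†_s = a†_{sₙ} ⋯ a†_{s₁}` for `s = {s₁ < ⋯ < sₙ}`, where `a†_j` creates `f j`. -/
def createSet (f : ι → H) (s : Finset ι) : Fock H →L[ℂ] Fock H :=
  ((s.sort (· ≤ ·)).reverse.map fun j => create (f j)).prod

/-- The weight `p(s) = ∏_{i ∈ s} pᵢ ∏_{j ∉ s} (1 - pⱼ)`. -/
def weight (p : ι → ℝ) (s : Finset ι) : ℝ :=
  (∏ i ∈ s, p i) * ∏' j : {j // j ∉ s}, (1 - p j)

/-- The operator `∑_s p(s) |a†_s Ω⟩⟨a†_s Ω|`, the sum being over all finite `s ⊆ ι`. -/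
def freeOperator (f : ι → H) (p : ι → ℝ) : Fock H →L[ℂ] Fock H :=
  ∑' s : Finset ι, (weight p s : ℂ) •
    InnerProductSpace.rankOne ℂ (createSet f s (vacuum H)) (createSet f s (vacuum H))

end Fock

/-- `- ∑ⱼ pⱼ log pⱼ - ∑ⱼ (1 - pⱼ) log (1 - pⱼ)` in `[0, ∞]`, for `pⱼ ∈ [0, 1]`. -/
def occupationEntropy {ι : Type v} (p : ι → ℝ) : ℝ≥0∞ :=
  ∑' j, ENNReal.ofReal (Real.negMulLog (p j)) + ∑' j, ENNReal.ofReal (Real.negMulLog (1 - p j))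

end

/-! The proof compares `Δ` with the free state by Klein's inequality. Let `Δ` have eigenbasis `b i`
with eigenvalues `l i`, and let `e s` be the occupation number vectors, which diagonalise the free
state with eigenvalues `P s = p(s)`. The scalar inequality `-x log x + x ≤ -x log y + y` at `x = l
i`, `y = P s`, weighted by `|⟨b i, e s⟩|²` and summed over all `(i, s)`, gives `S(Δ) + 1 ≤ ∑ₛ qₛ
(-log p(s)) + 1`, where `qₛ = ⟨e s, Δ e s⟩` (`entropy_le_cross`).

The cross entropy on the right depends only on the one-particle operator. Indeed `qₛ` is a
probability distribution on finite sets, and `∑_{s ∋ j} qₛ = Tr(Δ a†ⱼ aⱼ) = pⱼ`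
(`hasSum_occupation`). Since `log p(s)` is a sum over sites, interchanging sums turns the cross
entropy into the sum of the binary entropies of the `pⱼ` (`tsum_cross_entropy`). Hence the bound
holds for every state with the same one-particle operator. For the free state itself the cross
entropy is its entropy, so the bound is attained.

If equality holds and the value is finite, every term is an equality, and strictness of the scalar
inequality gives `l i = P s` whenever `⟨b i, e s⟩ ≠ 0`. Thus each `e s` is an eigenvector of `Δ`
with eigenvalue `p(s)`, which determines `Δ`.

The eigenbasis of `γ_Δ` exists because `γ_Δ` is positive with trace `Tr(Δ N) < ∞`, hence compact.
The same finiteness makes `∑ pⱼ` converge, whence `∑ₛ p(s) = 1` (`hasSum_weight`). -/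

section HilbertSpace

open scoped ComplexOrder

variable {E : Type u} [NormedAddCommGroup E] [InnerProductSpace ℂ E] {ι : Type*} {κ : Type*}

/-! ### Operators diagonal in a Hilbert basis -/

theorem HilbertBasis.hasSum_norm_inner_sq (b : HilbertBasis ι ℂ E) (v : E) :
    HasSum (fun i => ‖inner ℂ (b i) v‖ ^ 2) (‖v‖ ^ 2) := by
  have h3 := Complex.hasSum_re (b.hasSum_inner_mul_inner v v)
  convert h3 using 1
  · funext i
    rw [← inner_conj_symm v (b i), mul_comm, Complex.mul_conj, Complex.ofReal_re,
      Complex.normSq_eq_norm_sq]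
  · exact norm_sq_eq_re_inner (𝕜 := ℂ) v

theorem HilbertBasis.tsum_ofReal_norm_inner_sq (b : HilbertBasis ι ℂ E) (v : E) :
    ∑' i, ENNReal.ofReal (‖inner ℂ (b i) v‖ ^ 2) = ENNReal.ofReal (‖v‖ ^ 2) := by
  have h := b.hasSum_norm_inner_sq v
  rw [← ENNReal.ofReal_tsum_of_nonneg (fun _ => by positivity) h.summable, h.tsum_eq]

/-- An operator is determined by its eigenvectors and eigenvalues on a Hilbert basis. -/
theorem HilbertBasis.hasSum_apply_of_eigen (b : HilbertBasis ι ℂ E) {T : E →L[ℂ] E} {l : ι → ℝ}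
    (hT : ∀ i, T (b i) = (l i : ℂ) • b i) (v : E) :
    HasSum (fun i => ((l i : ℂ) * inner ℂ (b i) v) • b i) (T v) := by
  convert! (b.hasSum_repr v).mapL T using 1
  funext i
  rw [map_smul, hT, b.repr_apply_apply, smul_smul, mul_comm]

theorem HilbertBasis.hasSum_inner_apply_of_eigen (b : HilbertBasis ι ℂ E) {T : E →L[ℂ] E}
    {l : ι → ℝ} (hT : ∀ i, T (b i) = (l i : ℂ) • b i) (v w : E) :
    HasSum (fun i => (l i : ℂ) * (inner ℂ w (b i) * inner ℂ (b i) v)) (inner ℂ w (T v)) := by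
  convert! (b.hasSum_apply_of_eigen hT v).mapL (innerSL ℂ w) using 1
  funext i
  rw [innerSL_apply_apply, inner_smul_right]
  ring

theorem HilbertBasis.ext_clm (b : HilbertBasis ι ℂ E) {S T : E →L[ℂ] E}
    (h : ∀ i, S (b i) = T (b i)) : S = T := by
  ext v
  refine ((b.hasSum_repr v).mapL S).unique ?_
  convert! (b.hasSum_repr v).mapL T using 1
  funext i
  simp [h]

theorem HilbertBasis.ext_inner (b : HilbertBasis ι ℂ E) {v w : E}
    (h : ∀ i, inner ℂ (b i) v = inner ℂ (b i) w) : v = w := by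
  refine b.repr.injective (lp.ext (funext fun i => ?_))
  rw [b.repr_apply_apply, b.repr_apply_apply, h]

theorem HilbertBasis.inner_apply_of_eigen (b : HilbertBasis ι ℂ E) {T : E →L[ℂ] E}
    {l : ι → ℝ} (hT : ∀ i, T (b i) = (l i : ℂ) • b i) (v : E) (i : ι) :
    inner ℂ (b i) (T v) = (l i : ℂ) * inner ℂ (b i) v := by
  classical
  refine (b.hasSum_inner_apply_of_eigen hT v (b i)).unique ?_
  convert! hasSum_ite_eq i ((l i : ℂ) * inner ℂ (b i) v) using 1
  funext j
  rw [orthonormal_iff_ite.1 b.orthonormal]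
  by_cases hij : i = j
  · subst hij; simp
  · simp [hij, Ne.symm hij]

theorem HilbertBasis.hasSum_re_inner_apply_of_eigen (b : HilbertBasis ι ℂ E) {T : E →L[ℂ] E}
    {l : ι → ℝ} (hT : ∀ i, T (b i) = (l i : ℂ) • b i) (v : E) :
    HasSum (fun i => l i * ‖inner ℂ (b i) v‖ ^ 2) (inner ℂ v (T v)).re := by
  convert Complex.hasSum_re (b.hasSum_inner_apply_of_eigen hT v v) using 1
  funext i
  rw [← inner_conj_symm v (b i), mul_comm (conj _), Complex.mul_conj, Complex.re_ofReal_mul,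
    Complex.ofReal_re, Complex.normSq_eq_norm_sq]

theorem HilbertBasis.isPositive_of_eigen [CompleteSpace E] (b : HilbertBasis ι ℂ E) {T : E →L[ℂ] E}
    {l : ι → ℝ} (hl : ∀ i, 0 ≤ l i) (hT : ∀ i, T (b i) = (l i : ℂ) • b i) : T.IsPositive := by
  refine ContinuousLinearMap.isPositive_def'.2 ⟨?_, fun v => ?_⟩
  · rw [ContinuousLinearMap.isSelfAdjoint_iff_isSymmetric]
    intro v w
    change inner ℂ (T v) w = inner ℂ v (T w)
    have h1 := (b.hasSum_inner_apply_of_eigen hT v w)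
    have h2 := (b.hasSum_inner_apply_of_eigen hT w v)
    rw [← inner_conj_symm]
    refine HasSum.unique (f := fun i => (l i : ℂ) * (inner ℂ v (b i) * inner ℂ (b i) w)) ?_ h2
    convert Complex.hasSum_conj'.2 h1 using 1
    funext i
    rw [map_mul, map_mul, inner_conj_symm, inner_conj_symm, Complex.conj_ofReal]
    ring
  · rw [ContinuousLinearMap.reApplyInnerSelf_apply, ← inner_conj_symm, RCLike.conj_re]
    exact (b.hasSum_re_inner_apply_of_eigen hT v).nonneg fun i => mul_nonneg (hl i) (sq_nonneg _)

/-! ### Traces, compactness and the spectral theorem -/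

theorem isCompactOperator_rankOne (x y : E) :
    IsCompactOperator (InnerProductSpace.rankOne ℂ x y : E →L[ℂ] E) := by
  rw [InnerProductSpace.rankOne_def']
  exact (isCompactOperator_of_locallyCompactSpace_dom (innerSL ℂ y)).clm_comp
    (ContinuousLinearMap.toSpanSingleton ℂ x)

variable [CompleteSpace E]

/-- Turns diagonal entries `⟨x, T x⟩` into squared norms `‖S x‖²`, to which Parseval applies. -/
theorem ContinuousLinearMap.IsPositive.exists_sqrt {T : E →L[ℂ] E} (hT : T.IsPositive) :
    ∃ S : E →L[ℂ] E, T = ContinuousLinearMap.adjoint S ∘L S := by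
  obtain ⟨S, hS⟩ := CStarAlgebra.nonneg_iff_eq_star_mul_self.1
    ((ContinuousLinearMap.nonneg_iff_isPositive _).2 hT)
  exact ⟨S, hS⟩

/-- Parseval in `c`, Tonelli, then Parseval in `b`. Since the bases are arbitrary, the
Hilbert–Schmidt norm is independent of the basis. -/
theorem HilbertBasis.tsum_norm_apply_sq (b : HilbertBasis ι ℂ E) (c : HilbertBasis κ ℂ E)
    (S : E →L[ℂ] E) :
    ∑' i, ENNReal.ofReal (‖S (b i)‖ ^ 2)
      = ∑' j, ENNReal.ofReal (‖ContinuousLinearMap.adjoint S (c j)‖ ^ 2) := by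
  calc ∑' i, ENNReal.ofReal (‖S (b i)‖ ^ 2)
      = ∑' i, ∑' j, ENNReal.ofReal (‖inner ℂ (c j) (S (b i))‖ ^ 2) :=
        tsum_congr fun i => (c.tsum_ofReal_norm_inner_sq _).symm
    _ = ∑' j, ∑' i, ENNReal.ofReal (‖inner ℂ (c j) (S (b i))‖ ^ 2) := ENNReal.tsum_comm
    _ = _ := by
        refine tsum_congr fun j => ?_
        rw [← b.tsum_ofReal_norm_inner_sq]
        refine tsum_congr fun i => ?_
        rw [← ContinuousLinearMap.adjoint_inner_left, norm_inner_symm]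

theorem posTrace_eq_tsum {T : E →L[ℂ] E} (hT : T.IsPositive) (b : HilbertBasis ι ℂ E) :
    posTrace T = ∑' i, ENNReal.ofReal (inner ℂ (b i) (T (b i))).re := by
  obtain ⟨S, rfl⟩ := hT.exists_sqrt
  have h : ∀ x, (inner ℂ x ((ContinuousLinearMap.adjoint S ∘L S) x)).re = ‖S x‖ ^ 2 := by
    intro x
    rw [ContinuousLinearMap.comp_apply, ContinuousLinearMap.adjoint_inner_right]
    exact (norm_sq_eq_re_inner (𝕜 := ℂ) (S x)).symm
  simp only [posTrace, h]
  -- Both sides become the Hilbert–Schmidt sum of the adjoint of `S` in the chosen basis.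
  rw [(chosenBasis E).tsum_norm_apply_sq (chosenBasis E), b.tsum_norm_apply_sq (chosenBasis E)]

/-- Hilbert–Schmidt operators are norm limits of finite-rank ones: by Cauchy–Schwarz and Bessel,
`∑_{i ∈ t} |S bᵢ⟩⟨bᵢ|` has norm at most the square root of `∑_{i ∈ t} ‖S bᵢ‖²`. -/
theorem isCompactOperator_of_summable_norm_sq (b : HilbertBasis ι ℂ E) (S : E →L[ℂ] E)
    (hS : Summable fun i => ‖S (b i)‖ ^ 2) : IsCompactOperator S := by
  have hsum : Summable fun i => (InnerProductSpace.rankOne ℂ (S (b i)) (b i) : E →L[ℂ] E) := by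
    rw [summable_iff_vanishing_norm]
    intro ε hε
    obtain ⟨s, hs⟩ := summable_iff_vanishing_norm.1 hS ((ε / 2) ^ 2) (by positivity)
    refine ⟨s, fun t ht => lt_of_le_of_lt ?_ (half_lt_self hε)⟩
    have ht' := hs t ht
    rw [Real.norm_of_nonneg (Finset.sum_nonneg fun _ _ => sq_nonneg _)] at ht'
    refine ContinuousLinearMap.opNorm_le_bound _ (by positivity) fun v => ?_
    have hB : ∑ i ∈ t, ‖inner ℂ (b i) v‖ ^ 2 ≤ ‖v‖ ^ 2 := b.orthonormal.sum_inner_products_le v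
    calc ‖(∑ i ∈ t, InnerProductSpace.rankOne ℂ (S (b i)) (b i) : E →L[ℂ] E) v‖
        = ‖∑ i ∈ t, inner ℂ (b i) v • S (b i)‖ := by
          simp [sum_apply]
      _ ≤ ∑ i ∈ t, ‖inner ℂ (b i) v‖ * ‖S (b i)‖ :=
          (norm_sum_le _ _).trans_eq (Finset.sum_congr rfl fun _ _ => norm_smul _ _)
      _ ≤ √(∑ i ∈ t, ‖inner ℂ (b i) v‖ ^ 2) * √(∑ i ∈ t, ‖S (b i)‖ ^ 2) :=
          Real.sum_mul_le_sqrt_mul_sqrt _ _ _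
      _ ≤ ‖v‖ * (ε / 2) := by
          gcongr
          · exact Real.sqrt_le_iff.2 ⟨norm_nonneg _, hB⟩
          · exact Real.sqrt_le_iff.2 ⟨by positivity, ht'.le⟩
      _ = ε / 2 * ‖v‖ := mul_comm _ _
  have heq : ∑' i, (InnerProductSpace.rankOne ℂ (S (b i)) (b i) : E →L[ℂ] E) = S := by
    ext v
    have h1 := hsum.hasSum.mapL (ContinuousLinearMap.apply ℂ E v)
    refine h1.unique ?_
    convert! (b.hasSum_repr v).mapL S using 1
    funext i
    simp [b.repr_apply_apply]
  rw [← heq]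
  have htend : Filter.Tendsto (fun s : Finset ι => ∑ i ∈ s,
      (InnerProductSpace.rankOne ℂ (S (b i)) (b i) : E →L[ℂ] E)) Filter.atTop (nhds (∑' i,
        (InnerProductSpace.rankOne ℂ (S (b i)) (b i) : E →L[ℂ] E))) := hsum.hasSum
  refine isCompactOperator_of_tendsto htend (Filter.Eventually.of_forall fun s => ?_)
  have hmem : ∑ i ∈ s, (InnerProductSpace.rankOne ℂ (S (b i)) (b i) : E →L[ℂ] E)
      ∈ compactOperator (RingHom.id ℂ) E E :=
    sum_mem fun i _ => isCompactOperator_rankOne (S (b i)) (b i)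
  exact hmem

theorem ContinuousLinearMap.IsPositive.isCompactOperator {T : E →L[ℂ] E} (hT : T.IsPositive)
    (h : posTrace T < ∞) : IsCompactOperator T := by
  obtain ⟨S, rfl⟩ := hT.exists_sqrt
  suffices hs : Summable fun i => ‖S (chosenBasis E i)‖ ^ 2 from
    (isCompactOperator_of_summable_norm_sq (chosenBasis E) S hs).clm_comp
      (ContinuousLinearMap.adjoint S)
  have h' : ∀ x, (inner ℂ x ((ContinuousLinearMap.adjoint S ∘L S) x)).re = ‖S x‖ ^ 2 := by
    intro x
    rw [ContinuousLinearMap.comp_apply, ContinuousLinearMap.adjoint_inner_right]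
    exact (norm_sq_eq_re_inner (𝕜 := ℂ) (S x)).symm
  simp only [posTrace, h'] at h
  simpa [ENNReal.toReal_ofReal (sq_nonneg _)] using ENNReal.summable_toReal h.ne

/-- Eigenspaces of a compact symmetric operator, the kernel included, are mutually orthogonal with
trivial joint complement, so Hilbert bases of them together form one of `E`. The index `μ` runs over
all of `ℂ`; trivial eigenspaces contribute nothing. -/
theorem ContinuousLinearMap.IsPositive.exists_eigenbasis {T : E →L[ℂ] E} (hT : T.IsPositive)
    (h : posTrace T < ∞) :
    ∃ (ι : Type u) (b : HilbertBasis ι ℂ E) (l : ι → ℝ),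
      (∀ i, 0 ≤ l i) ∧ ∀ i, T (b i) = (l i : ℂ) • b i := by
  have hbot := ContinuousLinearMap.orthogonalComplement_iSup_eigenspaces_eq_bot
    (hT.isCompactOperator h) hT.isSymmetric
  let V : ℂ → Submodule ℂ E := fun μ => Module.End.eigenspace (T : Module.End ℂ E) μ
  have hV : OrthogonalFamily ℂ (fun μ => V μ) fun μ => (V μ).subtypeₗᵢ :=
    LinearMap.IsSymmetric.orthogonalFamily_eigenspaces hT.isSymmetric
  have hclosed : ∀ μ, CompleteSpace (V μ) := by
    intro μ
    have : IsClosed ((V μ : Submodule ℂ E) : Set E) := by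
      have : ((V μ : Submodule ℂ E) : Set E) = {x | T x = μ • x} := by
        ext x; exact Module.End.mem_eigenspace_iff
      rw [this]
      exact isClosed_eq T.continuous (continuous_const_smul μ)
    exact this.completeSpace_coe
  have hon := hV.orthonormal_sigma_orthonormal (fun μ => (chosenBasis (V μ)).orthonormal)
  have hperp : (Submodule.span ℂ (Set.range fun a : (Σ μ, basisSet (V μ)) =>
      (V a.1).subtypeₗᵢ (chosenBasis (V a.1) a.2)))ᗮ = ⊥ := by
    -- A vector orthogonal to the chosen basis of an eigenspace is orthogonal to the whole
    -- eigenspace, by expanding in that basis.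
    rw [eq_bot_iff, ← hbot, ← Submodule.iInf_orthogonal]
    intro x hx
    rw [Submodule.mem_iInf]
    intro μ
    rw [Submodule.mem_orthogonal']
    intro w hw
    have h1 := (((chosenBasis (V μ)).hasSum_repr ⟨w, hw⟩).mapL (V μ).subtypeL).mapL (innerSL ℂ x)
    refine h1.unique ?_
    convert! hasSum_zero using 1
    funext j
    have h2 : inner ℂ x ((chosenBasis (V μ) j : V μ) : E) = 0 :=
      (Submodule.mem_orthogonal' _ _).1 hx _ (Submodule.subset_span ⟨⟨μ, j⟩, rfl⟩)
    simp [h2]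
  have happ : ∀ a : (Σ μ, basisSet (V μ)), HilbertBasis.mkOfOrthogonalEqBot hon hperp a
      = ((chosenBasis (V a.1) a.2 : V a.1) : E) := fun a => by
    rw [HilbertBasis.coe_mkOfOrthogonalEqBot]; rfl
  have heig : ∀ a : (Σ μ, basisSet (V μ)), T ((chosenBasis (V a.1) a.2 : V a.1) : E)
      = a.1 • ((chosenBasis (V a.1) a.2 : V a.1) : E) := fun a =>
    Module.End.mem_eigenspace_iff.1 (chosenBasis (V a.1) a.2).2
  have hnonneg : ∀ a : (Σ μ, basisSet (V μ)), 0 ≤ a.1 := by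
    intro a
    have h1 := hT.inner_nonneg_right ((chosenBasis (V a.1) a.2 : V a.1) : E)
    have h2 : ‖((chosenBasis (V a.1) a.2 : V a.1) : E)‖ = 1 :=
      (chosenBasis (V a.1)).orthonormal.1 a.2
    rwa [heig, inner_smul_right, inner_self_eq_norm_sq_to_K, h2, RCLike.ofReal_one, one_pow,
      mul_one] at h1
  refine ⟨Σ μ, basisSet (V μ), HilbertBasis.mkOfOrthogonalEqBot hon hperp, fun a => a.1.re,
    fun a => (Complex.nonneg_iff.1 (hnonneg a)).1, fun a => ?_⟩
  rw [happ, heig]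
  congr 1
  exact Complex.ext rfl (Complex.nonneg_iff.1 (hnonneg a)).2.symm

/-- The continuous functional calculus acts on eigenvectors through the eigenvalue. -/
theorem cfc_apply_of_eigen {T : E →L[ℂ] E} (hT : IsSelfAdjoint T) {f : ℝ → ℝ} (hf : Continuous f)
    {v : E} {l : ℝ} (hv : T v = (l : ℂ) • v) : cfc f T v = (f l : ℂ) • v := by
  by_cases hv0 : v = 0
  · simp [hv0]
  have hl : l ∈ spectrum ℝ T := by
    rw [spectrum.mem_iff]
    intro hu
    obtain ⟨U, hU⟩ := hu
    have h0 : (U : E →L[ℂ] E) v = 0 := by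
      rw [hU, sub_apply, hv, Algebra.algebraMap_eq_smul_one, smul_apply,
        one_apply_eq_self, Complex.coe_smul, sub_self]
    refine hv0 ?_
    have : ((↑U⁻¹ : E →L[ℂ] E) * (U : E →L[ℂ] E)) v = v := by rw [Units.inv_mul]; rfl
    rw [← this, mul_apply_eq_comp, h0, map_zero]
  -- Stone–Weierstrass: the functions with this property are closed under sums, products and limits,
  -- and contain the constants and the identity.
  have key : ∀ g : C(spectrum ℝ T, ℝ), cfcHom hT g v = (g ⟨l, hl⟩ : ℂ) • v := by
    intro g
    induction g using ContinuousMap.induction_on_of_compact with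
    | const r =>
      have : ContinuousMap.const (spectrum ℝ T) r = algebraMap ℝ C(spectrum ℝ T, ℝ) r := rfl
      rw [this, AlgHomClass.commutes, Algebra.algebraMap_eq_smul_one, smul_apply,
        one_apply_eq_self, Complex.coe_smul]
      simp [Algebra.algebraMap_eq_smul_one]
    | id =>
      rw [cfcHom_id, hv]
      rfl
    | star_id =>
      rw [map_star, cfcHom_id, hT.star_eq, hv]
      rfl
    | add f g hf hg => rw [map_add, add_apply, hf, hg]; simp [add_smul]
    | mul f g hf hg =>
      rw [map_mul, mul_apply_eq_comp, hg, map_smul, hf, smul_smul]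
      simp [mul_comm]
    | frequently f hf =>
      have hcl : IsClosed {g : C(spectrum ℝ T, ℝ) | cfcHom hT g v = (g ⟨l, hl⟩ : ℂ) • v} := by
        refine isClosed_eq ?_ ?_
        · exact (ContinuousLinearMap.apply ℂ E v).continuous.comp (cfcHom_continuous hT)
        · exact (Complex.continuous_ofReal.comp (continuous_eval_const (F := C(spectrum ℝ T, ℝ)) _)).smul
            continuous_const
      exact hcl.mem_of_frequently_of_tendsto hf Filter.tendsto_id
  rw [cfc_apply f T hT hf.continuousOn, key]
  rfl

end HilbertSpace

/-! ### Traces and entropy in an eigenbasis -/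

namespace DensityOperator

open scoped ComplexOrder

variable {E : Type u} [NormedAddCommGroup E] [InnerProductSpace ℂ E] [CompleteSpace E]
  {ι : Type*} {κ : Type*} {X : DensityOperator E} {b : HilbertBasis ι ℂ E} {l : ι → ℝ}

theorem exists_eigenbasis (X : DensityOperator E) :
    ∃ (ι : Type u) (b : HilbertBasis ι ℂ E) (l : ι → ℝ),
      (∀ i, 0 ≤ l i) ∧ ∀ i, X.op (b i) = (l i : ℂ) • b i :=
  X.isPositive.exists_eigenbasis (by rw [X.posTrace_eq_one]; exact ENNReal.one_lt_top)

theorem _root_.posTrace_of_eigen (hl0 : ∀ i, 0 ≤ l i) {T : E →L[ℂ] E}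
    (hT : ∀ i, T (b i) = (l i : ℂ) • b i) : posTrace T = ∑' i, ENNReal.ofReal (l i) := by
  rw [posTrace_eq_tsum (b.isPositive_of_eigen hl0 hT) b]
  refine tsum_congr fun i => ?_
  rw [hT, inner_smul_right, inner_self_eq_norm_sq_to_K, b.orthonormal.1 i]
  simp

theorem hasSum_of_eigen (hl0 : ∀ i, 0 ≤ l i) (hT : ∀ i, X.op (b i) = (l i : ℂ) • b i) :
    HasSum l 1 := by
  have h := X.posTrace_eq_one
  rw [posTrace_of_eigen hl0 hT] at h
  have hs : Summable l := by
    have := ENNReal.summable_toReal (h.trans_ne ENNReal.one_ne_top)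
    simpa [ENNReal.toReal_ofReal (hl0 _)] using this
  rw [← ENNReal.ofReal_tsum_of_nonneg hl0 hs, ENNReal.ofReal_eq_one] at h
  exact h ▸ hs.hasSum

theorem le_one_of_eigen (hl0 : ∀ i, 0 ≤ l i) (hT : ∀ i, X.op (b i) = (l i : ℂ) • b i) (i : ι) :
    l i ≤ 1 :=
  le_hasSum (hasSum_of_eigen hl0 hT) i fun j _ => hl0 j

theorem entropy_of_eigen (hl0 : ∀ i, 0 ≤ l i) (hT : ∀ i, X.op (b i) = (l i : ℂ) • b i) :
    X.entropy = ∑' i, ENNReal.ofReal (Real.negMulLog (l i)) :=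
  posTrace_of_eigen (b := b)
    (fun i => Real.negMulLog_nonneg (hl0 i) (le_one_of_eigen hl0 hT i))
    fun i => cfc_apply_of_eigen X.isPositive.isSelfAdjoint Real.continuous_negMulLog (hT i)

/-- Basis independence of `Tr(X A)`: the double family `F` has row sums `lᵢ ⟨bᵢ, A bᵢ⟩` and column
sums `⟨cⱼ, X A cⱼ⟩`, and Fubini identifies the totals. -/
theorem hasSum_diag_of_eigen (hl0 : ∀ i, 0 ≤ l i) (hT : ∀ i, X.op (b i) = (l i : ℂ) • b i)
    (A : E →L[ℂ] E) (c : HilbertBasis κ ℂ E) :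
    HasSum (fun j => inner ℂ (c j) (X.op (A (c j))))
      (∑' i, (l i : ℂ) * inner ℂ (b i) (A (b i))) := by
  let F : ι × κ → ℂ := fun x =>
    (l x.1 : ℂ) * (inner ℂ (c x.2) (b x.1) * inner ℂ (b x.1) (A (c x.2)))
  have hl := hasSum_of_eigen hl0 hT
  have hrow : ∀ i, HasSum (fun j => F (i, j)) ((l i : ℂ) * inner ℂ (b i) (A (b i))) := by
    intro i
    have h := (c.hasSum_inner_mul_inner (ContinuousLinearMap.adjoint A (b i)) (b i)).mul_left
      (l i : ℂ)
    simp only [ContinuousLinearMap.adjoint_inner_left] at h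
    simpa only [F, mul_comm (inner ℂ (c _) (b i))] using h
  -- Domination by `|u v| ≤ (|u|² + |v|²) / 2`, whose row sums are at most `lᵢ (1 + ‖A*‖²) / 2` by
  -- Parseval.
  have hF : Summable F := by
    have hG : ∀ i, HasSum (fun j => l i * ((‖inner ℂ (c j) (b i)‖ ^ 2
        + ‖inner ℂ (c j) (ContinuousLinearMap.adjoint A (b i))‖ ^ 2) / 2))
        (l i * ((‖b i‖ ^ 2 + ‖ContinuousLinearMap.adjoint A (b i)‖ ^ 2) / 2)) := fun i =>
      (((c.hasSum_norm_inner_sq (b i)).add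
        (c.hasSum_norm_inner_sq (ContinuousLinearMap.adjoint A (b i)))).div_const 2).mul_left (l i)
    have hGs : Summable fun x : ι × κ => l x.1 * ((‖inner ℂ (c x.2) (b x.1)‖ ^ 2
        + ‖inner ℂ (c x.2) (ContinuousLinearMap.adjoint A (b x.1))‖ ^ 2) / 2) := by
      refine (summable_prod_of_nonneg fun x => mul_nonneg (hl0 _) (by positivity)).2
        ⟨fun i => (hG i).summable, ?_⟩
      simp only [(hG _).tsum_eq]
      refine Summable.of_nonneg_of_le (fun i => mul_nonneg (hl0 i) (by positivity)) (fun i => ?_)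
        (hl.summable.mul_right ((1 + ‖ContinuousLinearMap.adjoint A‖ ^ 2) / 2))
      have h1 : ‖b i‖ = 1 := b.orthonormal.1 i
      have h2 := (ContinuousLinearMap.adjoint A).le_opNorm (b i)
      rw [h1, mul_one] at h2
      rw [h1, one_pow]
      refine mul_le_mul_of_nonneg_left ?_ (hl0 i)
      gcongr
    refine Summable.of_norm_bounded hGs fun x => ?_
    rw [norm_mul, norm_mul, Complex.norm_real, Real.norm_of_nonneg (hl0 _)]
    refine mul_le_mul_of_nonneg_left ?_ (hl0 _)
    rw [← ContinuousLinearMap.adjoint_inner_left, norm_inner_symm (ContinuousLinearMap.adjoint A _)]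
    nlinarith [sq_nonneg (‖inner ℂ (c x.2) (b x.1)‖
      - ‖inner ℂ (c x.2) (ContinuousLinearMap.adjoint A (b x.1))‖)]
  have htot : ∑' i, (l i : ℂ) * inner ℂ (b i) (A (b i)) = ∑' x, F x :=
    (hF.hasSum.prod_fiberwise hrow).tsum_eq
  rw [htot]
  exact ((Equiv.prodComm κ ι).hasSum_iff.2 hF.hasSum).prod_fiberwise fun j =>
    b.hasSum_inner_apply_of_eigen hT (A (c j)) (c j)

theorem trace_of_eigen (hl0 : ∀ i, 0 ≤ l i) (hT : ∀ i, X.op (b i) = (l i : ℂ) • b i)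
    (A : E →L[ℂ] E) :
    trace (X.op ∘L A) = ∑' i, (l i : ℂ) * inner ℂ (b i) (A (b i)) :=
  (hasSum_diag_of_eigen hl0 hT A (chosenBasis E)).tsum_eq

theorem hasSum_diag (X : DensityOperator E) (A : E →L[ℂ] E) (c : HilbertBasis κ ℂ E) :
    HasSum (fun j => inner ℂ (c j) (X.op (A (c j)))) (trace (X.op ∘L A)) := by
  obtain ⟨ι, b, l, hl0, hT⟩ := X.exists_eigenbasis
  rw [trace_of_eigen hl0 hT]
  exact hasSum_diag_of_eigen hl0 hT A c

theorem trace_adjoint_comp_self_nonneg (X : DensityOperator E) (B : E →L[ℂ] E) :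
    0 ≤ trace (X.op ∘L ContinuousLinearMap.adjoint B ∘L B) := by
  obtain ⟨ι, b, l, hl0, hT⟩ := X.exists_eigenbasis
  rw [trace_of_eigen hl0 hT]
  refine tsum_nonneg fun i => mul_nonneg (by exact_mod_cast hl0 i) ?_
  rw [ContinuousLinearMap.comp_apply, ContinuousLinearMap.adjoint_inner_right,
    inner_self_eq_norm_sq_to_K]
  exact pow_nonneg (Complex.zero_le_real.2 (norm_nonneg (B (b i)))) 2

end DensityOperator

/-! ### Klein's inequality and its equality case -/

theorem Real.negMulLog_add_le {x y : ℝ} (hx : 0 ≤ x) (hy : 0 < y) :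
    Real.negMulLog x + x ≤ x * -Real.log y + y := by
  rcases hx.eq_or_lt with rfl | hx
  · simpa using hy.le
  -- This is `log u ≤ u - 1` at `u = y / x`, multiplied by `x`. With `x` and `y` kept on separate
  -- sides, both sides are nonnegative for `x, y ≤ 1` and can be summed in `[0, ∞]`.
  have h := mul_le_mul_of_nonneg_left (Real.log_le_sub_one_of_pos (div_pos hy hx)) hx.le
  rw [Real.log_div hy.ne' hx.ne', mul_sub, mul_sub, mul_div_cancel₀ _ hx.ne'] at h
  rw [Real.negMulLog]
  linarith

theorem Real.eq_of_negMulLog_add_eq {x y : ℝ} (hx : 0 ≤ x) (hy : 0 < y)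
    (h : Real.negMulLog x + x = x * -Real.log y + y) : x = y := by
  rcases hx.eq_or_lt with rfl | hx
  · simpa using h
  by_contra hne
  have h1 := mul_lt_mul_of_pos_left (Real.log_lt_sub_one_of_pos (div_pos hy hx)
    (fun h1 => hne ((div_eq_one_iff_eq hx.ne').1 h1).symm)) hx
  rw [Real.log_div hy.ne' hx.ne', mul_sub, mul_sub, mul_div_cancel₀ _ hx.ne'] at h1
  rw [Real.negMulLog] at h
  linarith

namespace DensityOperator

variable {E : Type u} [NormedAddCommGroup E] [InnerProductSpace ℂ E] [CompleteSpace E]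
  {ι : Type*} {κ : Type*} {X : DensityOperator E}

theorem hasSum_diag_re (X : DensityOperator E) (e : HilbertBasis κ ℂ E) :
    HasSum (fun s => (inner ℂ (e s) (X.op (e s))).re) 1 := by
  have h1 := X.posTrace_eq_one
  rw [posTrace_eq_tsum X.isPositive e] at h1
  have h0 : ∀ s, 0 ≤ (inner ℂ (e s) (X.op (e s))).re := fun s =>
    X.isPositive.re_inner_nonneg_right _
  have hs : Summable fun s => (inner ℂ (e s) (X.op (e s))).re := by
    have := ENNReal.summable_toReal (h1.trans_ne ENNReal.one_ne_top)
    simpa [ENNReal.toReal_ofReal (h0 _)] using this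
  rw [← ENNReal.ofReal_tsum_of_nonneg h0 hs, ENNReal.ofReal_eq_one] at h1
  exact h1 ▸ hs.hasSum

variable {b : HilbertBasis ι ℂ E} {l : ι → ℝ} {e : HilbertBasis κ ℂ E} {P : κ → ℝ}

theorem overlap_eq_zero (hl0 : ∀ i, 0 ≤ l i) (hT : ∀ i, X.op (b i) = (l i : ℂ) • b i) {v : E}
    (hv : (inner ℂ v (X.op v)).re = 0) (i : ι) : l i * ‖inner ℂ (b i) v‖ ^ 2 = 0 := by
  have h := b.hasSum_re_inner_apply_of_eigen hT v
  rw [hv, hasSum_zero_iff_of_nonneg fun i => mul_nonneg (hl0 i) (sq_nonneg _)] at h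
  exact congrFun h i

/-- Where `P s = 0`, the convention `Real.log 0 = 0` would break the scalar inequality; there `hq`
forces the eigenvalue or the overlap to vanish, so both sides are zero. -/
theorem klein_term_le (hl0 : ∀ i, 0 ≤ l i) (hT : ∀ i, X.op (b i) = (l i : ℂ) • b i)
    (hP0 : ∀ s, 0 ≤ P s) (hq : ∀ s, P s = 0 → (inner ℂ (e s) (X.op (e s))).re = 0)
    (i : ι) (s : κ) :
    ‖inner ℂ (b i) (e s)‖ ^ 2 * (Real.negMulLog (l i) + l i)
      ≤ ‖inner ℂ (b i) (e s)‖ ^ 2 * (l i * -Real.log (P s) + P s) := by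
  rcases (hP0 s).eq_or_lt with h | h
  · rcases mul_eq_zero.1 (overlap_eq_zero hl0 hT (hq s h.symm) i) with h' | h'
    · simp [h', ← h]
    · simp [h']
  · exact mul_le_mul_of_nonneg_left (Real.negMulLog_add_le (hl0 i) h) (sq_nonneg _)

/-- Summing over `s` first, Parseval removes the overlaps; the `1` is `∑ l i`. -/
theorem tsum_klein_left (hl0 : ∀ i, 0 ≤ l i) (hT : ∀ i, X.op (b i) = (l i : ℂ) • b i)
    (e : HilbertBasis κ ℂ E) :
    ∑' x : ι × κ, ENNReal.ofReal
      (‖inner ℂ (b x.1) (e x.2)‖ ^ 2 * (Real.negMulLog (l x.1) + l x.1)) = X.entropy + 1 := by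
  have hη : ∀ i, 0 ≤ Real.negMulLog (l i) := fun i =>
    Real.negMulLog_nonneg (hl0 i) (le_one_of_eigen hl0 hT i)
  rw [entropy_of_eigen hl0 hT, ← X.posTrace_eq_one, posTrace_of_eigen hl0 hT, ← ENNReal.tsum_add,
    ENNReal.tsum_prod (f := fun i s => ENNReal.ofReal
      (‖inner ℂ (b i) (e s)‖ ^ 2 * (Real.negMulLog (l i) + l i)))]
  refine tsum_congr fun i => ?_
  simp only [ENNReal.ofReal_mul (sq_nonneg _), ENNReal.tsum_mul_right, norm_inner_symm (b i)]
  rw [e.tsum_ofReal_norm_inner_sq, b.orthonormal.1 i, one_pow, ENNReal.ofReal_one, one_mul,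
    ENNReal.ofReal_add (hη i) (hl0 i)]

/-- Summing over `i` first, the overlaps weighted by `l i` add up to `⟨e s, X e s⟩` and the
unweighted ones to `1`; the final `1` is `∑ P s`. -/
theorem tsum_klein_right (hl0 : ∀ i, 0 ≤ l i) (hT : ∀ i, X.op (b i) = (l i : ℂ) • b i)
    (hP0 : ∀ s, 0 ≤ P s) (hP : HasSum P 1) :
    ∑' x : ι × κ, ENNReal.ofReal
      (‖inner ℂ (b x.1) (e x.2)‖ ^ 2 * (l x.1 * -Real.log (P x.2) + P x.2))
      = ∑' s, ENNReal.ofReal ((inner ℂ (e s) (X.op (e s))).re * -Real.log (P s)) + 1 := by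
  have hlog : ∀ s, 0 ≤ -Real.log (P s) := fun s =>
    neg_nonneg.2 (Real.log_nonpos (hP0 s) (le_hasSum hP s fun j _ => hP0 j))
  have h1 : (1 : ℝ≥0∞) = ∑' s, ENNReal.ofReal (P s) := by
    rw [← ENNReal.ofReal_tsum_of_nonneg hP0 hP.summable, hP.tsum_eq, ENNReal.ofReal_one]
  rw [h1, ← ENNReal.tsum_add, ENNReal.tsum_prod (f := fun i s => ENNReal.ofReal
      (‖inner ℂ (b i) (e s)‖ ^ 2 * (l i * -Real.log (P s) + P s))), ENNReal.tsum_comm]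
  refine tsum_congr fun s => ?_
  have hA := (b.hasSum_re_inner_apply_of_eigen hT (e s)).mul_right (-Real.log (P s))
  have hB := (b.hasSum_norm_inner_sq (e s)).mul_right (P s)
  have hAB := hA.add hB
  have hq0 : 0 ≤ (inner ℂ (e s) (X.op (e s))).re := X.isPositive.re_inner_nonneg_right _
  rw [e.orthonormal.1 s, one_pow, one_mul] at hAB
  rw [← ENNReal.ofReal_add (mul_nonneg hq0 (hlog s)) (hP0 s),
    ← hAB.tsum_eq, ENNReal.ofReal_tsum_of_nonneg _ hAB.summable]
  · exact tsum_congr fun i => by congr 1; ring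
  · exact fun i => add_nonneg (mul_nonneg (mul_nonneg (hl0 i) (sq_nonneg _)) (hlog s))
      (mul_nonneg (sq_nonneg _) (hP0 s))

/-- Klein's inequality against a state that is diagonal in the basis `e` with weights `P`. -/
theorem entropy_le_cross (hP0 : ∀ s, 0 ≤ P s) (hP : HasSum P 1)
    (hq : ∀ s, P s = 0 → (inner ℂ (e s) (X.op (e s))).re = 0) :
    X.entropy ≤ ∑' s, ENNReal.ofReal ((inner ℂ (e s) (X.op (e s))).re * -Real.log (P s)) := by
  obtain ⟨ι, b, l, hl0, hT⟩ := X.exists_eigenbasis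
  rw [← ENNReal.add_le_add_iff_right ENNReal.one_ne_top, ← tsum_klein_left hl0 hT e,
    ← tsum_klein_right hl0 hT hP0 hP]
  exact ENNReal.tsum_le_tsum fun x => ENNReal.ofReal_le_ofReal (klein_term_le hl0 hT hP0 hq x.1 x.2)

/-- The equality case of Klein's inequality. -/
theorem apply_eq_of_entropy_eq_cross (hP0 : ∀ s, 0 ≤ P s) (hP : HasSum P 1)
    (hq : ∀ s, P s = 0 → (inner ℂ (e s) (X.op (e s))).re = 0)
    (heq : X.entropy = ∑' s, ENNReal.ofReal ((inner ℂ (e s) (X.op (e s))).re * -Real.log (P s)))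
    (hfin : X.entropy < ∞) (s : κ) : X.op (e s) = (P s : ℂ) • e s := by
  obtain ⟨ι, b, l, hl0, hT⟩ := X.exists_eigenbasis
  refine b.ext_inner fun i => ?_
  rw [b.inner_apply_of_eigen hT, inner_smul_right]
  have hle := klein_term_le hl0 hT hP0 hq i s
  have hη : 0 ≤ Real.negMulLog (l i) :=
    Real.negMulLog_nonneg (hl0 i) (le_one_of_eigen hl0 hT i)
  have hterm : ‖inner ℂ (b i) (e s)‖ ^ 2 * (Real.negMulLog (l i) + l i)
      = ‖inner ℂ (b i) (e s)‖ ^ 2 * (l i * -Real.log (P s) + P s) := by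
    -- One strict term would make the totals differ, because the left total `S + 1` is finite.
    refine hle.eq_of_not_lt fun hlt => ?_
    have h1 := tsum_klein_left hl0 hT e
    have h2 := tsum_klein_right (e := e) hl0 hT hP0 hP
    rw [← heq, ← h1] at h2
    refine (ENNReal.tsum_lt_tsum (i := (i, s)) ?_ (fun x => ENNReal.ofReal_le_ofReal
      (klein_term_le hl0 hT hP0 hq x.1 x.2)) ?_).ne h2.symm
    · rw [h1]
      exact ENNReal.add_ne_top.2 ⟨hfin.ne, ENNReal.one_ne_top⟩
    · refine (ENNReal.ofReal_lt_ofReal_iff_of_nonneg ?_).2 hlt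
      exact mul_nonneg (sq_nonneg _) (add_nonneg hη (hl0 i))
  by_cases h0 : inner ℂ (b i) (e s) = 0
  · simp [h0]
  have hm : ‖inner ℂ (b i) (e s)‖ ^ 2 ≠ 0 := by simpa using h0
  -- If `P s = 0`, the nonzero overlap forces `l i = 0`; otherwise the equality case of the scalar
  -- inequality applies.
  have hlP : l i = P s := by
    rcases (hP0 s).eq_or_lt with h | h
    · rw [← h]
      exact (mul_eq_zero.1 (overlap_eq_zero hl0 hT (hq s h.symm) i)).resolve_right hm
    · exact Real.eq_of_negMulLog_add_eq (hl0 i) h (mul_left_cancel₀ hm hterm)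
  rw [hlP]

end DensityOperator

namespace Fock

variable {H : Type u} [NormedAddCommGroup H] [InnerProductSpace ℂ H]

/-! ### Canonical anticommutation relations -/

theorem eq_of_inner_incl {ψ φ : Fock H} (h : ∀ x, inner ℂ (incl x) ψ = inner ℂ (incl x) φ) :
    ψ = φ := by
  refine ext_inner_left ℂ fun v => ?_
  exact congrFun (denseRange_incl.equalizer (g := fun v => inner ℂ v ψ) (h := fun v => inner ℂ v φ)
    (by fun_prop) (by fun_prop) (funext h)) v

/-- Contraction with `⟨h, ·⟩` on the algebraic Fock space. -/
noncomputable def contract (h : H) : FockAlg H →ₗ[ℂ] FockAlg H := PreFock.contr h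

theorem contract_wedge (h g : H) (x : FockAlg H) :
    contract h (wedge g x) = inner ℂ h g • x - wedge g (contract h x) :=
  PreFock.contr_ι_mul h g x

theorem wedge_wedge (h g : H) (x : FockAlg H) : wedge h (wedge g x) = -wedge g (wedge h x) := by
  let x' : ExteriorAlgebra ℂ H := x
  change ExteriorAlgebra.ι ℂ h * (ExteriorAlgebra.ι ℂ g * x')
    = -(ExteriorAlgebra.ι ℂ g * (ExteriorAlgebra.ι ℂ h * x'))
  rw [← mul_assoc, ← mul_assoc, ← neg_mul,
    eq_neg_of_add_eq_zero_left (ExteriorAlgebra.ι_add_mul_swap (R := ℂ) h g)]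

theorem annihilate_incl (h : H) (x : FockAlg H) :
    annihilate h (incl x) = incl (contract h x) := by
  refine eq_of_inner_incl fun y => ?_
  rw [annihilate, ContinuousLinearMap.adjoint_inner_right, create_incl, incl.inner_map_map,
    incl.inner_map_map]
  exact PreFock.form_ι_mul_left h y x

/-- On the exterior algebra this is the antiderivation rule for contraction; density and boundedness
extend it. -/
theorem annihilate_create (h g : H) (ψ : Fock H) :
    annihilate h (create g ψ) = inner ℂ h g • ψ - create g (annihilate h ψ) := by
  have : annihilate h ∘L create g
      = inner ℂ h g • ContinuousLinearMap.id ℂ (Fock H) - create g ∘L annihilate h := by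
    refine eq_of_incl fun x => ?_
    simp only [ContinuousLinearMap.comp_apply, sub_apply, smul_apply,
      ContinuousLinearMap.id_apply, create_incl, annihilate_incl]
    rw [← map_smul, ← map_sub, contract_wedge]
  exact congrArg (fun T : Fock H →L[ℂ] Fock H => T ψ) this

theorem create_create (h g : H) (ψ : Fock H) :
    create h (create g ψ) = -create g (create h ψ) := by
  have : create h ∘L create g = -(create g ∘L create h) := by
    refine eq_of_incl fun x => ?_
    simp only [ContinuousLinearMap.comp_apply, neg_apply, create_incl]
    rw [← map_neg, wedge_wedge]
  exact congrArg (fun T : Fock H →L[ℂ] Fock H => T ψ) this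

theorem create_create_self (h : H) (ψ : Fock H) : create h (create h ψ) = 0 := by
  have h1 := create_create h h ψ
  rw [eq_neg_iff_add_eq_zero, ← two_smul ℂ] at h1
  exact (smul_eq_zero.1 h1).resolve_left two_ne_zero

theorem annihilate_vacuum (h : H) : annihilate h (vacuum H) = 0 := by
  rw [vacuum, annihilate_incl]
  have : contract h (FockAlg.one : FockAlg H) = 0 := PreFock.contr_one h
  rw [this, map_zero]

theorem inner_annihilate_right (h : H) (ψ φ : Fock H) :
    inner ℂ ψ (annihilate h φ) = inner ℂ (create h ψ) φ :=
  ContinuousLinearMap.adjoint_inner_right _ _ _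

theorem inner_annihilate_left (h : H) (ψ φ : Fock H) :
    inner ℂ (annihilate h ψ) φ = inner ℂ ψ (create h φ) :=
  ContinuousLinearMap.adjoint_inner_left _ _ _

theorem annihilate_annihilate_self (h : H) (ψ : Fock H) :
    annihilate h (annihilate h ψ) = 0 := by
  refine ext_inner_left ℂ fun φ => ?_
  rw [inner_annihilate_right, inner_annihilate_right, create_create_self, inner_zero_left,
    inner_zero_right]

theorem annihilate_adjoint (h : H) : ContinuousLinearMap.adjoint (annihilate h) = create h :=
  ContinuousLinearMap.adjoint_adjoint _

theorem norm_vacuum : ‖vacuum H‖ = 1 := by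
  have h : (inner ℂ (vacuum H) (vacuum H) : ℂ) = 1 := by
    rw [vacuum, incl.inner_map_map]
    exact (PreFock.form_one_left (H := H) 1).trans (map_one _)
  have h2 : ‖vacuum H‖ ^ 2 = 1 := by rw [norm_sq_eq_re_inner (𝕜 := ℂ), h, RCLike.one_re]
  exact (pow_eq_one_iff_of_nonneg (norm_nonneg _) two_ne_zero).1 h2

/-! ### Products of creators applied to the vacuum -/

/-- `a†_{L₁} ⋯ a†_{Lₙ} Ω`. -/
noncomputable def createList (L : List H) : Fock H := L.foldr (fun h ψ => create h ψ) (vacuum H)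

@[simp] theorem createList_nil : createList ([] : List H) = vacuum H := rfl

@[simp] theorem createList_cons (h : H) (L : List H) :
    createList (h :: L) = create h (createList L) := rfl

/-- Different particle numbers are orthogonal. The vectors are arbitrary, so that occupation vectors
built from two different bases of `H` can be compared. -/
theorem inner_createList_of_length_ne (L : List H) :
    ∀ M : List H, L.length ≠ M.length → inner ℂ (createList L) (createList M) = 0 := by
  suffices h : ∀ (n : ℕ) (L : List H), L.length = n → ∀ M : List H, n ≠ M.length →
      inner ℂ (createList L) (createList M) = 0 from h _ L rfl
  -- An annihilator removes one factor. Writing `K.length + 1 = m` makes the span zero for `m = 0`,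
  -- in agreement with `a_h Ω = 0`.
  have hann : ∀ (h : H) (M : List H) (m : ℕ), M.length = m →
      annihilate h (createList M)
        ∈ Submodule.span ℂ (createList '' {K : List H | K.length + 1 = m}) := by
    intro h M
    induction M with
    | nil => intro m _; rw [createList_nil, annihilate_vacuum]; exact zero_mem _
    | cons g M ih =>
      intro m hm
      rw [createList_cons, annihilate_create]
      refine sub_mem (Submodule.smul_mem _ _ (Submodule.subset_span ⟨M, hm, rfl⟩)) ?_
      have hmap := Submodule.mem_map_of_mem (f := (create g : Fock H →ₗ[ℂ] Fock H)) (ih _ rfl)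
      rw [Submodule.map_span] at hmap
      refine Submodule.span_mono ?_ hmap
      rintro _ ⟨_, ⟨K, hK, rfl⟩, rfl⟩
      exact ⟨g :: K, by simp only [Set.mem_ofPred_eq, List.length_cons] at *; omega, rfl⟩
  intro n
  induction n with
  | zero =>
    intro L hL M hM
    rw [List.length_eq_zero_iff.1 hL]
    cases M with
    | nil => simp at hM
    | cons g M =>
      rw [createList_cons, ← inner_annihilate_left, createList_nil, annihilate_vacuum,
        inner_zero_left]
  | succ n ih =>
    intro L hL M hM
    cases L with
    | nil => simp at hL
    | cons g L =>
      rw [createList_cons, ← inner_annihilate_right]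
      have h1 := hann g M _ rfl
      generalize annihilate g (createList M) = φ at h1
      induction h1 using Submodule.span_induction with
      | mem x hx =>
        obtain ⟨K, hK, rfl⟩ := hx
        simp only [Set.mem_ofPred_eq, List.length_cons] at *
        exact ih L (by omega) K (by omega)
      | zero => exact inner_zero_right _
      | add x y _ _ hx hy => rw [inner_add_right, hx, hy, add_zero]
      | smul c x _ hx => rw [inner_smul_right, hx, mul_zero]

theorem createList_perm {L M : List H} (h : L.Perm M) :
    createList L = createList M ∨ createList L = -createList M := by
  induction h with
  | nil => exact Or.inl rfl
  | cons x _ ih =>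
    rcases ih with ih | ih
    · exact Or.inl (by simp [ih])
    · exact Or.inr (by simp [ih])
  | swap x y l => exact Or.inr (create_create _ _ _)
  | trans _ _ h1 h2 =>
    rcases h1 with h1 | h1 <;> rcases h2 with h2 | h2 <;> simp [h1, h2]

theorem createList_of_mem {L : List H} {h : H} (hL : h ∈ L) : create h (createList L) = 0 := by
  induction L with
  | nil => simp at hL
  | cons g L ih =>
    rw [createList_cons]
    rcases List.mem_cons.1 hL with rfl | hL
    · exact create_create_self _ _
    · rw [create_create, ih hL, map_zero, neg_zero]

theorem createList_of_not_nodup {L : List H} (hL : ¬ L.Nodup) : createList L = 0 := by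
  induction L with
  | nil => simp at hL
  | cons g L ih =>
    rw [createList_cons]
    by_cases hg : g ∈ L
    · exact createList_of_mem hg
    · rw [ih fun h => hL (List.nodup_cons.2 ⟨hg, h⟩), map_zero]

/-- The closed span is stable under creators from `s`, hence under all creators because `h ↦ a†_h ψ`
is linear and continuous. As it contains `Ω`, it contains the exterior algebra. -/
theorem topologicalClosure_span_createList {s : Set H}
    (hs : (Submodule.span ℂ s).topologicalClosure = ⊤) :
    (Submodule.span ℂ (createList '' {L : List H | ∀ h ∈ L, h ∈ s})).topologicalClosure = ⊤ := by
  set W := Submodule.span ℂ (createList '' {L : List H | ∀ h ∈ L, h ∈ s}) with hW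
  have hcl : IsClosed (W.topologicalClosure : Set (Fock H)) := W.isClosed_topologicalClosure
  have h1 : ∀ h ∈ s, ∀ ψ ∈ W.topologicalClosure, create h ψ ∈ W.topologicalClosure := by
    intro h hh ψ hψ
    have h2 : W ≤ W.comap (create h : Fock H →ₗ[ℂ] Fock H) := by
      refine Submodule.span_le.2 ?_
      rintro _ ⟨L, hL, rfl⟩
      refine Submodule.subset_span ⟨h :: L, ?_, rfl⟩
      simpa [hh] using hL
    exact map_mem_closure (create h).continuous hψ fun x hx => h2 hx
  have h2 : ∀ h, ∀ ψ ∈ W.topologicalClosure, create h ψ ∈ W.topologicalClosure := by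
    intro h ψ hψ
    let Φ : H →ₗ[ℂ] Fock H :=
      { toFun := fun h => create h ψ
        map_add' := fun a b => by rw [create_add, add_apply]
        map_smul' := fun c a => by rw [create_smul, smul_apply, RingHom.id_apply] }
    have hΦ : Continuous Φ := by
      refine (LinearMap.mkContinuous Φ ‖ψ‖ fun h => ?_).continuous
      refine ((create h).le_opNorm ψ).trans ?_
      rw [mul_comm]
      exact mul_le_mul_of_nonneg_left (norm_create_le h) (norm_nonneg _)
    have h3 : Submodule.span ℂ s ≤ W.topologicalClosure.comap Φ :=
      Submodule.span_le.2 fun h hh => h1 h hh ψ hψ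
    have h4 : (Submodule.span ℂ s).topologicalClosure ≤ W.topologicalClosure.comap Φ :=
      Submodule.topologicalClosure_minimal _ h3 (hcl.preimage hΦ)
    exact h4 (hs ▸ Submodule.mem_top : h ∈ (Submodule.span ℂ s).topologicalClosure)
  have h3 : ∀ x : FockAlg H, incl x ∈ W.topologicalClosure := by
    intro x
    refine PreFock.ext_induction (H := H)
      (C := fun x => incl (show FockAlg H from x) ∈ W.topologicalClosure) ?_ ?_ ?_ ?_ x
    · exact W.le_topologicalClosure (Submodule.subset_span ⟨[], by simp, rfl⟩)
    · intro x y hx hy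
      exact (incl.map_add (show FockAlg H from x) y).symm ▸ add_mem hx hy
    · intro c x hx
      exact (incl.map_smul c (show FockAlg H from x)).symm ▸ Submodule.smul_mem _ c hx
    · intro h x hx
      exact create_incl h (show FockAlg H from x) ▸ h2 h _ hx
  rw [eq_top_iff]
  intro ψ _
  exact denseRange_incl.induction_on ψ hcl h3

/-! ### Occupation numbers -/

section Orthonormal

variable {ι : Type v} {f : ι → H}

theorem annihilate_createList_of_notMem (hf : Orthonormal ℂ f) {i : ι} {L : List ι} (hi : i ∉ L) :
    annihilate (f i) (createList (L.map f)) = 0 := by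
  induction L with
  | nil => exact annihilate_vacuum _
  | cons j L ih =>
    rw [List.mem_cons, not_or] at hi
    rw [List.map_cons, createList_cons, annihilate_create, ih hi.2, map_zero, hf.2 hi.1, zero_smul,
      sub_zero]

/-- `a†ᵢ aᵢ` passes `a†ⱼ` for `j ≠ i` with two cancelling signs, and acts as the identity on
reaching `a†ᵢ`. -/
theorem create_annihilate_createList_of_mem (hf : Orthonormal ℂ f) {i : ι} {L : List ι}
    (hi : i ∈ L) (hL : L.Nodup) :
    create (f i) (annihilate (f i) (createList (L.map f))) = createList (L.map f) := by
  classical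
  induction L with
  | nil => simp at hi
  | cons j L ih =>
    rw [List.nodup_cons] at hL
    rw [List.map_cons, createList_cons]
    by_cases hij : i = j
    · subst hij
      rw [annihilate_create, annihilate_createList_of_notMem hf hL.1, map_zero, sub_zero, map_smul,
        inner_self_eq_norm_sq_to_K, hf.1 i]
      simp
    · rw [annihilate_create, hf.2 hij, zero_smul, zero_sub, map_neg, create_create, neg_neg,
        ih ((List.mem_cons.1 hi).resolve_left hij) hL.2]

theorem norm_createList (hf : Orthonormal ℂ f) {L : List ι} (hL : L.Nodup) :
    ‖createList (L.map f)‖ = 1 := by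
  induction L with
  | nil => exact norm_vacuum
  | cons j L ih =>
    rw [List.nodup_cons] at hL
    have h : (inner ℂ (createList ((j :: L).map f)) (createList ((j :: L).map f)) : ℂ)
        = inner ℂ (createList (L.map f)) (createList (L.map f)) := by
      rw [List.map_cons, createList_cons, ← inner_annihilate_right, annihilate_create,
        annihilate_createList_of_notMem hf hL.1, map_zero, sub_zero, inner_smul_right,
        inner_self_eq_norm_sq_to_K (f j), hf.1 j]
      simp
    have h2 : ‖createList ((j :: L).map f)‖ ^ 2 = 1 := by
      rw [norm_sq_eq_re_inner (𝕜 := ℂ), h, ← norm_sq_eq_re_inner (𝕜 := ℂ), ih hL.2, one_pow]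
    exact (pow_eq_one_iff_of_nonneg (norm_nonneg _) two_ne_zero).1 h2

variable [LinearOrder ι]

/-- The occupation number vector `a†_s Ω`. -/
noncomputable def occ (f : ι → H) (s : Finset ι) : Fock H := createSet f s (vacuum H)

theorem occ_eq_createList (f : ι → H) (s : Finset ι) :
    occ f s = createList ((s.sort (· ≤ ·)).reverse.map f) := by
  rw [occ, createSet]
  generalize (s.sort (· ≤ ·)).reverse = L
  induction L with
  | nil => rfl
  | cons j L ih =>
    rw [List.map_cons, List.prod_cons, mul_apply_eq_comp, ih]
    rfl

theorem create_annihilate_occ (hf : Orthonormal ℂ f) (i : ι) (s : Finset ι) :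
    create (f i) (annihilate (f i) (occ f s)) = if i ∈ s then occ f s else 0 := by
  rw [occ_eq_createList]
  split_ifs with h
  · exact create_annihilate_createList_of_mem hf (by simpa using h)
      (List.nodup_reverse.2 (s.sort_nodup _))
  · rw [annihilate_createList_of_notMem hf (by simpa using h), map_zero]

theorem annihilate_occ_of_notMem (hf : Orthonormal ℂ f) {i : ι} {s : Finset ι} (h : i ∉ s) :
    annihilate (f i) (occ f s) = 0 := by
  rw [occ_eq_createList]
  exact annihilate_createList_of_notMem hf (by simpa using h)

theorem inner_create_annihilate_occ (hf : Orthonormal ℂ f) (i : ι) (s : Finset ι) (ψ : Fock H) :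
    inner ℂ (occ f s) (create (f i) (annihilate (f i) ψ))
      = if i ∈ s then inner ℂ (occ f s) ψ else 0 := by
  rw [← inner_annihilate_left, inner_annihilate_right, create_annihilate_occ hf]
  split_ifs <;> simp

theorem orthonormal_occ (hf : Orthonormal ℂ f) : Orthonormal ℂ (occ f) := by
  refine ⟨fun s => ?_, fun s t hst => ?_⟩
  · rw [occ_eq_createList]
    exact norm_createList hf (List.nodup_reverse.2 (s.sort_nodup _))
  -- At such a site, `a†ᵢ aᵢ` has eigenvalue `1` on one vector and `0` on the other.
  · have h : ∃ i, ¬ (i ∈ s ↔ i ∈ t) := by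
      by_contra! h
      exact hst (Finset.ext h)
    obtain ⟨i, hi⟩ := h
    have h1 := inner_create_annihilate_occ hf i s (occ f t)
    rw [create_annihilate_occ hf] at h1
    by_cases his : i ∈ s <;> by_cases hit : i ∈ t <;> simp_all

theorem inner_occ_of_card_ne {κ : Type*} [LinearOrder κ] (f : ι → H) (g : κ → H) {s : Finset ι}
    {t : Finset κ} (h : s.card ≠ t.card) : inner ℂ (occ f s) (occ g t) = 0 := by
  rw [occ_eq_createList, occ_eq_createList]
  exact inner_createList_of_length_ne _ _ (by simpa using h)

end Orthonormal

variable {ι : Type v} [LinearOrder ι]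

/-- A product of basis creators on `Ω` vanishes if an index repeats, and otherwise is an occupation
vector up to the sign of the sorting permutation. -/
theorem topologicalClosure_span_occ (f : HilbertBasis ι ℂ H) :
    (Submodule.span ℂ (Set.range (occ f))).topologicalClosure = ⊤ := by
  rw [← topologicalClosure_span_createList f.dense_span]
  congr 1
  refine le_antisymm (Submodule.span_mono ?_) (Submodule.span_le.2 ?_)
  · rintro _ ⟨s, rfl⟩
    refine ⟨_, ?_, (occ_eq_createList f s).symm⟩
    intro h hh
    obtain ⟨i, -, rfl⟩ := List.mem_map.1 hh
    exact ⟨i, rfl⟩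
  · rintro _ ⟨L, hL, rfl⟩
    obtain ⟨M, rfl⟩ : ∃ M : List ι, M.map f = L := by
      have : L ∈ Set.range (List.map f) := by
        rw [Set.range_list_map]
        exact hL
      exact this
    by_cases hM : M.Nodup
    · have hp : M.Perm (M.toFinset.sort (· ≤ ·)).reverse := by
        refine List.perm_of_nodup_nodup_toFinset_eq hM
          (List.nodup_reverse.2 (Finset.sort_nodup _ _)) ?_
        ext; simp
      rcases createList_perm (hp.map f) with h | h
      · rw [h, ← occ_eq_createList]
        exact Submodule.subset_span ⟨_, rfl⟩
      · rw [h, ← occ_eq_createList]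
        exact neg_mem (Submodule.subset_span ⟨_, rfl⟩)
    · rw [createList_of_not_nodup fun h => hM h.of_map]
      exact zero_mem _

/-- The occupation number basis of Fock space. -/
noncomputable def occBasis (f : HilbertBasis ι ℂ H) : HilbertBasis (Finset ι) ℂ (Fock H) :=
  HilbertBasis.mk (orthonormal_occ f.orthonormal) (topologicalClosure_span_occ f).ge

@[simp] theorem occBasis_apply (f : HilbertBasis ι ℂ H) (s : Finset ι) :
    occBasis f s = occ f s :=
  congrFun (HilbertBasis.coe_mk _ _) s

end Fock

namespace Fock

variable {H : Type u} [NormedAddCommGroup H] [InnerProductSpace ℂ H]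
  {ι : Type v} [LinearOrder ι]

/-! ### The number operator in an occupation number basis -/

/-- Describes `N` as multiplication by `|s|` in coordinates. The partial sum over `F` multiplies the
coefficient at `s` by `|F ∩ s|`, so its error there is at most that of `φ` and is zero once `s ⊆ F`:
dominated convergence. -/
theorem hasSum_number_iff (c : HilbertBasis ι ℂ H) (ψ φ : Fock H) :
    HasSum (fun j => create (c j) (annihilate (c j) ψ)) φ ↔
      ∀ s, (s.card : ℂ) * inner ℂ (occ c s) ψ = inner ℂ (occ c s) φ := by
  have hcoef : ∀ (s F : Finset ι), inner ℂ (occ c s)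
      (∑ j ∈ F, create (c j) (annihilate (c j) ψ)) = ((F ∩ s).card : ℂ) * inner ℂ (occ c s) ψ := by
    intro s F
    simp only [inner_sum, inner_create_annihilate_occ c.orthonormal]
    rw [← Finset.sum_filter, Finset.sum_const, nsmul_eq_mul, Finset.filter_mem_eq_inter]
  constructor
  · intro h s
    have h1 := h.mapL (innerSL ℂ (occ c s))
    refine HasSum.unique ?_ h1
    convert! hasSum_sum_of_ne_finset_zero (s := s) (f := fun j =>
      innerSL ℂ (occ c s) (create (c j) (annihilate (c j) ψ))) ?_ using 1
    · simp only [innerSL_apply_apply]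
      rw [← inner_sum, hcoef, Finset.inter_self]
    · intro j hj
      rw [innerSL_apply_apply, inner_create_annihilate_occ c.orthonormal, if_neg hj]
    · infer_instance
  · intro h
    rw [HasSum, SummationFilter.unconditional_filter, Metric.tendsto_atTop]
    intro ε hε
    have hφ := (occBasis c).hasSum_norm_inner_sq φ
    obtain ⟨S, hS⟩ := Metric.tendsto_atTop.1 hφ (ε ^ 2) (by positivity)
    -- For such `F` the coefficients at every `s ∈ S` are exact, and the rest is bounded by the tail
    -- of `‖φ‖²` outside `S`.
    refine ⟨S.biUnion id, fun F hF => ?_⟩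
    have h1 := (occBasis c).hasSum_norm_inner_sq (∑ j ∈ F, create (c j) (annihilate (c j) ψ) - φ)
    have h2 : HasSum (fun s => if s ∈ S then 0 else ‖inner ℂ (occBasis c s) φ‖ ^ 2)
        (‖φ‖ ^ 2 - ∑ s ∈ S, ‖inner ℂ (occBasis c s) φ‖ ^ 2) := by
      have h3 : HasSum (fun s => if s ∈ S then ‖inner ℂ (occBasis c s) φ‖ ^ 2 else 0)
          (∑ s ∈ S, ‖inner ℂ (occBasis c s) φ‖ ^ 2) := by
        convert! hasSum_sum_of_ne_finset_zero (s := S)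
          (f := fun s => if s ∈ S then ‖inner ℂ (occBasis c s) φ‖ ^ 2 else 0) ?_ using 1
        · exact (Finset.sum_congr rfl fun s hs => if_pos hs).symm
        · exact fun s hs => if_neg hs
        · infer_instance
      convert! hφ.sub h3 using 1
      funext s
      split_ifs <;> simp
    have hle : ‖∑ j ∈ F, create (c j) (annihilate (c j) ψ) - φ‖ ^ 2
        ≤ ‖φ‖ ^ 2 - ∑ s ∈ S, ‖inner ℂ (occBasis c s) φ‖ ^ 2 := by
      refine hasSum_le (fun s => ?_) h1 h2
      rw [inner_sub_right, occBasis_apply, hcoef]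
      split_ifs with hs
      · have hsF : s ⊆ F := fun j hj => hF (Finset.mem_biUnion.2 ⟨s, hs, hj⟩)
        rw [Finset.inter_eq_right.2 hsF, h]
        simp
      · rw [← h, ← sub_mul, norm_mul, norm_mul]
        have : ‖((F ∩ s).card : ℂ) - (s.card : ℂ)‖ ≤ ‖(s.card : ℂ)‖ := by
          have h5 : (F ∩ s).card ≤ s.card := Finset.card_le_card Finset.inter_subset_right
          rw [norm_sub_rev, ← Nat.cast_sub h5, Complex.norm_natCast, Complex.norm_natCast]
          exact_mod_cast Nat.sub_le _ _
        gcongr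
    have h4 := hS S le_rfl
    rw [dist_comm, Real.dist_eq] at h4
    rw [dist_eq_norm]
    exact lt_of_pow_lt_pow_left₀ 2 hε.le (hle.trans_lt ((le_abs_self _).trans_lt h4))

/-- A bounded operator that respects the particle number commutes with the number operator. -/
theorem hasSum_number_apply (c : HilbertBasis ι ℂ H) {A : Fock H →L[ℂ] Fock H}
    (hA : ∀ s t, s.card ≠ t.card → inner ℂ (occ c s) (A (occ c t)) = 0) {ψ φ : Fock H}
    (h : HasSum (fun j => create (c j) (annihilate (c j) ψ)) φ) :
    HasSum (fun j => create (c j) (annihilate (c j) (A ψ))) (A φ) := by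
  rw [hasSum_number_iff] at h ⊢
  intro s
  have hexp : ∀ χ, HasSum (fun t => inner ℂ (occ c t) χ * inner ℂ (occ c s) (A (occ c t)))
      (inner ℂ (occ c s) (A χ)) := by
    intro χ
    convert! (((occBasis c).hasSum_repr χ).mapL A).mapL (innerSL ℂ (occ c s)) using 1
    funext t
    simp [HilbertBasis.repr_apply_apply]
  refine ((hexp ψ).mul_left (s.card : ℂ)).unique ?_
  convert! hexp φ using 1
  funext t
  rw [← h t]
  by_cases hst : s.card = t.card
  · rw [hst, mul_assoc]
  · rw [hA s t hst]
    simp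

/-- Makes the one-particle operator of a state diagonal in `occ f` diagonal in `f`. If `i ∈ s`,
write the left vector as `a†ᵢ aᵢ` of itself, move `a†ᵢ` across, and use the anticommutation of `aᵢ`
with `a†ⱼ` and `aᵢ² = 0`. -/
theorem inner_occ_create_annihilate_of_ne {f : ι → H} (hf : Orthonormal ℂ f) {i j : ι}
    (hij : i ≠ j) (s : Finset ι) :
    inner ℂ (occ f s) (create (f j) (annihilate (f i) (occ f s))) = 0 := by
  by_cases his : i ∈ s
  · have h := create_annihilate_occ hf i s
    rw [if_pos his] at h
    nth_rw 1 [← h]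
    rw [← inner_annihilate_right, annihilate_create, annihilate_annihilate_self, map_zero,
      hf.2 hij, zero_smul, sub_zero, inner_zero_right]
  · rw [annihilate_occ_of_notMem hf his, map_zero, inner_zero_right]

variable [CompleteSpace H]

/-! ### One-particle operators -/

theorem isPositive_oneParticle (Δ : DensityOperator (Fock H)) : (oneParticle Δ).IsPositive := by
  refine (ContinuousLinearMap.isPositive_iff_complex _).2 fun g => ?_
  have h := Δ.trace_adjoint_comp_self_nonneg (annihilate g)
  rw [annihilate_adjoint, ← inner_oneParticle, Complex.nonneg_iff] at h
  have hz : inner ℂ (oneParticle Δ g) g = inner ℂ g (oneParticle Δ g) := by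
    rw [← inner_conj_symm, Complex.conj_eq_iff_im.2 h.2.symm]
  rw [hz]
  exact ⟨Complex.ext rfl h.2, h.1⟩

theorem posTrace_oneParticle (Δ : DensityOperator (Fock H)) :
    posTrace (oneParticle Δ) = meanNumber Δ := by
  simp only [posTrace, inner_oneParticle, meanNumber]

/-- The occupation probabilities of a state, summed over the sets that contain `j`. -/
theorem hasSum_occupation (Δ : DensityOperator (Fock H)) (f : HilbertBasis ι ℂ H) {p : ι → ℝ}
    {j : ι} (hp : oneParticle Δ (f j) = (p j : ℂ) • f j) :
    HasSum (fun s => if j ∈ s then (inner ℂ (occ f s) (Δ.op (occ f s))).re else 0) (p j) := by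
  have h := Complex.hasSum_re (Δ.hasSum_diag (create (f j) ∘L annihilate (f j)) (occBasis f))
  rw [← inner_oneParticle, hp, inner_smul_right, inner_self_eq_norm_sq_to_K, f.orthonormal.1 j] at h
  convert h using 1
  · funext s
    rw [occBasis_apply, ContinuousLinearMap.comp_apply, create_annihilate_occ f.orthonormal]
    split_ifs <;> simp
  · simp

theorem oneParticle_of_eigen {Γ : DensityOperator (Fock H)} {f : HilbertBasis ι ℂ H}
    {P : Finset ι → ℝ} (hP0 : ∀ s, 0 ≤ P s) (hΓ : ∀ s, Γ.op (occ f s) = (P s : ℂ) • occ f s)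
    {p : ι → ℝ} (hp : ∀ j, HasSum (fun s => if j ∈ s then P s else 0) (p j)) (j : ι) :
    oneParticle Γ (f j) = (p j : ℂ) • f j := by
  refine f.ext_inner fun i => ?_
  rw [inner_oneParticle, DensityOperator.trace_of_eigen (b := occBasis f) hP0 (by simpa using hΓ),
    inner_smul_right]
  simp only [occBasis_apply, ContinuousLinearMap.comp_apply]
  by_cases hij : i = j
  · subst hij
    rw [inner_self_eq_norm_sq_to_K, f.orthonormal.1 i]
    have h := (Complex.hasSum_ofReal.2 (hp i)).tsum_eq
    simp only [RCLike.ofReal_one, one_pow, mul_one]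
    rw [← h]
    refine tsum_congr fun s => ?_
    rw [inner_create_annihilate_occ f.orthonormal, inner_self_eq_norm_sq_to_K,
      (orthonormal_occ f.orthonormal).1 s]
    split_ifs <;> simp
  · simp only [inner_occ_create_annihilate_of_ne f.orthonormal hij, mul_zero, tsum_zero]
    rw [f.orthonormal.2 hij, mul_zero]

theorem commutesWithNumber_of_eigen {Γ : DensityOperator (Fock H)} {f : HilbertBasis ι ℂ H}
    {P : Finset ι → ℝ} (hΓ : ∀ s, Γ.op (occ f s) = (P s : ℂ) • occ f s) :
    CommutesWithNumber Γ := by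
  intro ψ
  classical
  let : LinearOrder (basisSet H) := linearOrderOfSTO WellOrderingRel
  -- `number` is built on `chosenBasis H`, not on `f`. In the expansion over `occ f w`, each `w`
  -- differs in cardinality from `s` or from `t`, so every term vanishes.
  have hA : ∀ s t, s.card ≠ t.card →
      inner ℂ (occ (chosenBasis H) s) (Γ.op (occ (chosenBasis H) t)) = 0 := by
    intro s t hst
    refine ((occBasis f).hasSum_inner_apply_of_eigen (by simpa using hΓ) _ _).unique ?_
    convert! hasSum_zero using 1
    funext w
    by_cases hw : s.card = w.card
    · rw [occBasis_apply, inner_occ_of_card_ne f (chosenBasis H) (hw ▸ hst), mul_zero, mul_zero]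
    · rw [occBasis_apply, inner_occ_of_card_ne (chosenBasis H) f hw, zero_mul, mul_zero]
  have hψ : Summable fun j => create (chosenBasis H j) (annihilate (chosenBasis H j) (ψ : Fock H)) :=
    ψ.2
  have h := hasSum_number_apply (chosenBasis H) hA hψ.hasSum
  exact ⟨h.summable, h.tsum_eq⟩

end Fock

namespace Fock

variable {ι : Type v} {p : ι → ℝ}

/-! ### The weights of a free state -/

open Classical in
/-- The probability that the site `j` is in the state prescribed by `s`. -/
noncomputable def siteWeight (p : ι → ℝ) (s : Finset ι) (j : ι) : ℝ :=
  if j ∈ s then p j else 1 - p j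

theorem siteWeight_of_mem {s : Finset ι} {j : ι} (h : j ∈ s) : siteWeight p s j = p j := if_pos h

theorem siteWeight_of_notMem {s : Finset ι} {j : ι} (h : j ∉ s) : siteWeight p s j = 1 - p j :=
  if_neg h

theorem siteWeight_nonneg (hp0 : ∀ j, 0 ≤ p j) (hp1 : ∀ j, p j ≤ 1) (s : Finset ι) (j : ι) :
    0 ≤ siteWeight p s j := by
  rw [siteWeight]; split_ifs
  · exact hp0 j
  · exact sub_nonneg.2 (hp1 j)

theorem siteWeight_le_one (hp0 : ∀ j, 0 ≤ p j) (hp1 : ∀ j, p j ≤ 1) (s : Finset ι) (j : ι) :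
    siteWeight p s j ≤ 1 := by
  rw [siteWeight]; split_ifs
  · exact hp1 j
  · exact sub_le_self _ (hp0 j)

theorem multipliable_one_sub (hp : Summable p) : Multipliable fun j => 1 - p j := by
  simpa [sub_eq_add_neg] using Real.multipliable_one_add_of_summable hp.neg

open Classical in
theorem multipliable_tail (hp : Summable p) (s : Finset ι) :
    Multipliable fun j => if j ∈ s then 1 else 1 - p j := by
  have h := multipliable_one_sub (p := fun j => if j ∈ s then 0 else p j) ?_
  · convert h using 2 with j
    split_ifs <;> simp
  · refine hp.congr_cofinite ?_
    filter_upwards [s.finite_toSet.compl_mem_cofinite] with j hj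
    exact (if_neg hj).symm

open Classical in
theorem hasProd_mul_tail (hp : Summable p) (s : Finset ι) (g : ι → ℝ) :
    HasProd (fun j => if j ∈ s then g j else 1 - p j)
      ((∏ j ∈ s, g j) * ∏' j, if j ∈ s then 1 else 1 - p j) := by
  have h1 : HasProd (fun j => if j ∈ s then g j else 1) (∏ j ∈ s, g j) := by
    convert! hasProd_prod_of_ne_finset_one (s := s) (f := fun j => if j ∈ s then g j else 1) ?_
      using 1
    · exact (Finset.prod_congr rfl fun j hj => if_pos hj).symm
    · exact fun j hj => if_neg hj
    · infer_instance
  convert! h1.mul (multipliable_tail hp s).hasProd using 1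
  funext j
  split_ifs <;> simp

open Classical in
theorem weight_eq_prod_mul_tail (s : Finset ι) :
    weight p s = (∏ i ∈ s, p i) * ∏' j, if j ∈ s then 1 else 1 - p j := by
  rw [weight]
  congr 1
  have h := tprod_subtype {j | j ∉ s} (fun j => 1 - p j)
  refine Eq.trans h (tprod_congr fun j => ?_)
  rw [Set.mulIndicator_apply]
  by_cases hj : j ∈ s <;> simp [hj]

theorem hasProd_weight (hp : Summable p) (s : Finset ι) :
    HasProd (siteWeight p s) (weight p s) := by
  rw [weight_eq_prod_mul_tail]
  exact hasProd_mul_tail hp s p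

open Classical in
-- The infinite factor depends on `F` alone, so it can be pulled out of a sum over the subsets of
-- `F`.
theorem weight_eq_of_subset (hp : Summable p) {s F : Finset ι} (h : s ⊆ F) :
    weight p s = (∏ j ∈ F, siteWeight p s j) * ∏' j, if j ∈ F then 1 else 1 - p j := by
  refine (hasProd_weight hp s).unique ?_
  convert! hasProd_mul_tail hp F (siteWeight p s) using 1
  funext j
  by_cases hj : j ∈ F
  · rw [if_pos hj]
  · rw [if_neg hj, siteWeight_of_notMem fun hs => hj (h hs)]

theorem weight_nonneg (hp : Summable p) (hp0 : ∀ j, 0 ≤ p j) (hp1 : ∀ j, p j ≤ 1) (s : Finset ι) :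
    0 ≤ weight p s :=
  ge_of_tendsto' (hasProd_weight hp s) fun _ =>
    Finset.prod_nonneg fun j _ => siteWeight_nonneg hp0 hp1 s j

theorem weight_le_siteWeight (hp : Summable p) (hp0 : ∀ j, 0 ≤ p j) (hp1 : ∀ j, p j ≤ 1)
    (s : Finset ι) (j : ι) : weight p s ≤ siteWeight p s j := by
  classical
  refine le_of_tendsto (hasProd_weight hp s) ?_
  rw [SummationFilter.unconditional_filter]
  filter_upwards [Filter.eventually_ge_atTop {j}] with F hF
  rw [← Finset.mul_prod_erase F _ (hF (Finset.mem_singleton_self j))]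
  exact mul_le_of_le_one_right (siteWeight_nonneg hp0 hp1 s j)
    (Finset.prod_le_one (fun j _ => siteWeight_nonneg hp0 hp1 s j)
      fun j _ => siteWeight_le_one hp0 hp1 s j)

open Classical in
-- After the common tail is factored out, what remains is the expansion of `∏_{j ∈ F} (pⱼ + (1 -
-- pⱼ)) = 1`.
theorem sum_powerset_weight (hp : Summable p) (F : Finset ι) :
    ∑ s ∈ F.powerset, weight p s = ∏' j, if j ∈ F then 1 else 1 - p j := by
  have h1 : ∑ s ∈ F.powerset, ∏ j ∈ F, siteWeight p s j = 1 := by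
    have h2 := Finset.prod_add p (fun j => 1 - p j) F
    simp only [add_sub_cancel, Finset.prod_const_one] at h2
    rw [h2]
    refine Finset.sum_congr rfl fun s hs => ?_
    rw [← Finset.prod_sdiff (Finset.mem_powerset.1 hs), mul_comm]
    congr 1
    · exact Finset.prod_congr rfl fun j hj => siteWeight_of_mem hj
    · exact Finset.prod_congr rfl fun j hj => siteWeight_of_notMem (Finset.mem_sdiff.1 hj).2
  rw [Finset.sum_congr rfl fun s hs => weight_eq_of_subset hp (Finset.mem_powerset.1 hs),
    ← Finset.sum_mul, h1, one_mul]

/-- Weierstrass's product inequality; it bounds the tail products from below. -/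
theorem one_sub_sum_le_prod (hp0 : ∀ j, 0 ≤ p j) (hp1 : ∀ j, p j ≤ 1) (F : Finset ι) :
    1 - ∑ j ∈ F, p j ≤ ∏ j ∈ F, (1 - p j) := by
  classical
  induction F using Finset.induction_on with
  | empty => simp
  | insert j F hj ih =>
    rw [Finset.sum_insert hj, Finset.prod_insert hj]
    have h1 : ∏ j ∈ F, (1 - p j) ≤ 1 :=
      Finset.prod_le_one (fun j _ => sub_nonneg.2 (hp1 j)) fun j _ => sub_le_self _ (hp0 j)
    nlinarith [hp0 j]

open Classical in
theorem one_sub_tsum_le_tail (hp : Summable p) (hp0 : ∀ j, 0 ≤ p j) (hp1 : ∀ j, p j ≤ 1)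
    (F : Finset ι) :
    1 - (∑' j, p j - ∑ j ∈ F, p j) ≤ ∏' j, if j ∈ F then 1 else 1 - p j := by
  refine ge_of_tendsto' (multipliable_tail hp F).hasProd fun G => ?_
  -- Setting `p` to zero on `F` puts the tail product into the form of the finite inequality.
  let q : ι → ℝ := fun j => if j ∈ F then 0 else p j
  have hq : ∑ j ∈ G, q j + ∑ j ∈ F, p j ≤ ∑' j, p j := by
    have h1 : ∑ j ∈ G, q j = ∑ j ∈ G \ F, p j := by
      rw [Finset.sum_ite, Finset.sum_const_zero, zero_add]
      congr 1
      ext; simp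
    rw [h1, ← Finset.sum_union Finset.sdiff_disjoint]
    exact hp.sum_le_tsum _ fun j _ => hp0 j
  have h2 := one_sub_sum_le_prod (p := q)
    (fun j => by simp only [q]; split_ifs <;> simp [hp0])
    (fun j => by simp only [q]; split_ifs <;> simp [hp1]) G
  have h3 : ∏ j ∈ G, (1 - q j) = ∏ j ∈ G, if j ∈ F then 1 else 1 - p j :=
    Finset.prod_congr rfl fun j _ => by simp only [q]; split_ifs <;> simp
  rw [← h3]
  linarith

open Classical in
theorem tail_le_one (hp : Summable p) (hp0 : ∀ j, 0 ≤ p j) (hp1 : ∀ j, p j ≤ 1)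
    (F : Finset ι) : (∏' j, if j ∈ F then 1 else 1 - p j) ≤ 1 := by
  refine le_of_tendsto' (multipliable_tail hp F).hasProd fun G => ?_
  refine Finset.prod_le_one (fun j _ => ?_) (fun j _ => ?_) <;> split_ifs <;> simp [hp0, hp1]

/-- Any finite family of sets lies in the powerset of its union `F`, and the weights on that
powerset sum to the tail product outside `F`, which lies between `1 - ∑_{j ∉ F} pⱼ` and `1`. -/
theorem hasSum_weight (hp : Summable p) (hp0 : ∀ j, 0 ≤ p j) (hp1 : ∀ j, p j ≤ 1) :
    HasSum (weight p) 1 := by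
  classical
  have hw := weight_nonneg hp hp0 hp1
  refine hasSum_of_isLUB_of_nonneg 1 hw ⟨?_, fun c hc => ?_⟩
  · rintro _ ⟨S, rfl⟩
    calc ∑ s ∈ S, weight p s ≤ ∑ s ∈ (S.biUnion id).powerset, weight p s :=
          Finset.sum_le_sum_of_subset_of_nonneg (fun s hs => Finset.mem_powerset.2
            (Finset.subset_biUnion_of_mem id hs)) fun s _ _ => hw s
      _ ≤ 1 := by
          rw [sum_powerset_weight hp]
          exact tail_le_one hp hp0 hp1 _
  · have h1 : Filter.Tendsto (fun F : Finset ι => 1 - (∑' j, p j - ∑ j ∈ F, p j)) Filter.atTop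
        (nhds (1 - (∑' j, p j - ∑' j, p j))) :=
      tendsto_const_nhds.sub (tendsto_const_nhds.sub hp.hasSum)
    rw [sub_self, sub_zero] at h1
    refine le_of_tendsto' h1 fun F => ?_
    refine (one_sub_tsum_le_tail hp hp0 hp1 F).trans ?_
    rw [← sum_powerset_weight hp]
    exact hc ⟨_, rfl⟩

/-- The probability that the site `j` is occupied is `p j`. -/
theorem hasSum_weight_of_mem [DecidableEq ι] (hp : Summable p) (hp0 : ∀ j, 0 ≤ p j)
    (hp1 : ∀ j, p j ≤ 1) (j : ι) :
    HasSum (fun s => if j ∈ s then weight p s else 0) (p j) := by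
  -- Conditioning on `j` being occupied: `p j * weight q s` equals `weight p s` if `j ∈ s`, and is
  -- zero otherwise because the factor `1 - q j` vanishes.
  let q : ι → ℝ := Function.update p j 1
  have hqj : q j = 1 := Function.update_self _ _ _
  have hq : ∀ i, i ≠ j → q i = p i := fun i hi => Function.update_of_ne hi _ _
  have hqs : Summable q := by
    refine hp.congr_cofinite ?_
    filter_upwards [(Set.finite_singleton j).compl_mem_cofinite] with i hi
    exact (hq i hi).symm
  have h := (hasSum_weight hqs
    (fun i => by by_cases hi : i = j <;> simp_all)
    (fun i => by by_cases hi : i = j <;> simp_all)).mul_left (p j)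
  rw [mul_one] at h
  convert! h using 1
  funext s
  split_ifs with hj
  · rw [weight, weight, ← Finset.mul_prod_erase s p hj, ← Finset.mul_prod_erase s q hj, hqj,
      one_mul, ← mul_assoc]
    congr 1
    · congr 1
      exact Finset.prod_congr rfl fun i hi => (hq i (Finset.ne_of_mem_erase hi)).symm
    · exact tprod_congr fun i => by rw [hq i (fun hi => i.2 (hi ▸ hj))]
  · have h0 : weight q s = 0 := by
      refine le_antisymm ?_ (weight_nonneg hqs
        (fun i => by by_cases hi : i = j <;> simp_all)
        (fun i => by by_cases hi : i = j <;> simp_all) s)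
      refine (weight_le_siteWeight hqs
        (fun i => by by_cases hi : i = j <;> simp_all)
        (fun i => by by_cases hi : i = j <;> simp_all) s j).trans_eq ?_
      rw [siteWeight_of_notMem hj, hqj, sub_self]
    rw [h0, mul_zero]

/-- The set `s` alone contributes `q s` to the probability that `j` is occupied (if `j ∈ s`) or
empty (if not). This yields the support condition in Klein's inequality. -/
theorem siteWeight_pos_of_occupation [DecidableEq ι] {q : Finset ι → ℝ} (hq0 : ∀ s, 0 ≤ q s)
    (hq1 : HasSum q 1)
    (hq : ∀ j, HasSum (fun s => if j ∈ s then q s else 0) (p j))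
    {s : Finset ι} (hs : 0 < q s) (j : ι) : 0 < siteWeight p s j := by
  by_cases hj : j ∈ s
  · rw [siteWeight_of_mem hj]
    have h := le_hasSum (hq j) s fun t _ => by split_ifs <;> simp [hq0]
    rw [if_pos hj] at h
    exact hs.trans_le h
  · rw [siteWeight_of_notMem hj]
    have h := le_hasSum (hq1.sub (hq j)) s fun t _ => by split_ifs <;> simp [hq0]
    rw [if_neg hj, sub_zero] at h
    exact hs.trans_le h

theorem summable_log_siteWeight (hp : Summable p) (s : Finset ι) :
    Summable fun j => Real.log (siteWeight p s j) := by
  classical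
  have h := Real.summable_log_one_add_of_summable hp.neg
  refine h.congr_cofinite ?_
  filter_upwards [s.finite_toSet.compl_mem_cofinite] with j hj
  rw [siteWeight_of_notMem hj, sub_eq_add_neg]

/-- An infinite product of positive factors may still be zero; summability of the logarithms
excludes this. -/
theorem weight_pos (hp : Summable p) {s : Finset ι} (h : ∀ j, 0 < siteWeight p s j) :
    0 < weight p s := by
  rw [← (hasProd_weight hp s).tprod_eq,
    ← Real.rexp_tsum_eq_tprod h (summable_log_siteWeight hp s)]
  exact Real.exp_pos _

theorem log_weight (hp : Summable p) {s : Finset ι} (h : ∀ j, 0 < siteWeight p s j) :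
    Real.log (weight p s) = ∑' j, Real.log (siteWeight p s j) := by
  rw [← (hasProd_weight hp s).tprod_eq,
    ← Real.rexp_tsum_eq_tprod h (summable_log_siteWeight hp s), Real.log_exp]

/-- The cross entropy of a distribution with occupation probabilities `p j` relative to the
weights of the free state depends only on the `p j`. -/
theorem tsum_cross_entropy [DecidableEq ι] (hp : Summable p) (hp0 : ∀ j, 0 ≤ p j)
    (hp1 : ∀ j, p j ≤ 1)
    {q : Finset ι → ℝ} (hq0 : ∀ s, 0 ≤ q s) (hq1 : HasSum q 1)
    (hq : ∀ j, HasSum (fun s => if j ∈ s then q s else 0) (p j)) :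
    ∑' s, ENNReal.ofReal (q s * -Real.log (weight p s)) = occupationEntropy p := by
  have hlog : ∀ s j, 0 ≤ -Real.log (siteWeight p s j) := fun s j =>
    neg_nonneg.2 (Real.log_nonpos (siteWeight_nonneg hp0 hp1 s j) (siteWeight_le_one hp0 hp1 s j))
  -- The logarithm is split over the sites only where `q s > 0`, since there all site factors are
  -- positive.
  have h1 : ∀ s, ENNReal.ofReal (q s * -Real.log (weight p s))
      = ∑' j, ENNReal.ofReal (q s * -Real.log (siteWeight p s j)) := by
    intro s
    rcases (hq0 s).eq_or_lt with h | h
    · simp [← h]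
    · have hpos := siteWeight_pos_of_occupation hq0 hq1 hq h
      rw [log_weight hp hpos, ← tsum_neg, ← tsum_mul_left, ENNReal.ofReal_tsum_of_nonneg]
      · exact fun j => mul_nonneg (hq0 s) (hlog s j)
      · exact (summable_log_siteWeight hp s).neg.mul_left _
  rw [tsum_congr h1, ENNReal.tsum_comm, occupationEntropy, ← ENNReal.tsum_add]
  refine tsum_congr fun j => ?_
  -- At a fixed site the logarithm takes two values, with total probabilities `p j` and `1 - p j`.
  have h2 := ((hq j).mul_right (-Real.log (p j))).add
    ((hq1.sub (hq j)).mul_right (-Real.log (1 - p j)))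
  have h3 : (fun s => q s * -Real.log (siteWeight p s j)) = fun s =>
      (if j ∈ s then q s else 0) * -Real.log (p j)
        + (q s - if j ∈ s then q s else 0) * -Real.log (1 - p j) := by
    funext s
    rw [siteWeight]
    split_ifs <;> simp
  rw [← h3] at h2
  rw [← ENNReal.ofReal_tsum_of_nonneg (fun s => mul_nonneg (hq0 s) (hlog s j)) h2.summable,
    h2.tsum_eq, ← ENNReal.ofReal_add (Real.negMulLog_nonneg (hp0 j) (hp1 j))
      (Real.negMulLog_nonneg (sub_nonneg.2 (hp1 j)) (sub_le_self _ (hp0 j)))]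
  simp only [Real.negMulLog, mul_neg, neg_mul]

end Fock

namespace Fock

variable {H : Type u} [NormedAddCommGroup H] [InnerProductSpace ℂ H]
  {ι : Type v} [LinearOrder ι]

/-! ### Free states -/

theorem freeOperator_occ (f : HilbertBasis ι ℂ H) {p : ι → ℝ} (hp : Summable p)
    (hp0 : ∀ j, 0 ≤ p j) (hp1 : ∀ j, p j ≤ 1) (t : Finset ι) :
    freeOperator f p (occ f t) = (weight p t : ℂ) • occ f t := by
  have ho := orthonormal_occ f.orthonormal
  -- The series converges absolutely in operator norm, so the `tsum` defining `freeOperator` is not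
  -- its default value `0`.
  have hs : Summable fun s : Finset ι =>
      (weight p s : ℂ) • InnerProductSpace.rankOne ℂ (occ f s) (occ f s) := by
    refine Summable.of_norm_bounded (hasSum_weight hp hp0 hp1).summable fun s => ?_
    rw [norm_smul, InnerProductSpace.norm_rankOne, ho.1 s, Complex.norm_real,
      Real.norm_of_nonneg (weight_nonneg hp hp0 hp1 s), mul_one, mul_one]
  have h1 := hs.hasSum.mapL (ContinuousLinearMap.apply ℂ (Fock H) (occ f t))
  refine h1.unique ?_
  convert! hasSum_ite_eq t ((weight p t : ℂ) • occ f t) using 1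
  funext s
  rw [ContinuousLinearMap.apply_apply, smul_apply, InnerProductSpace.rankOne_apply,
    orthonormal_iff_ite.1 ho]
  by_cases hst : s = t
  · subst hst; simp
  · simp [hst]

theorem op_eq_freeOperator_iff {Δ : DensityOperator (Fock H)} (f : HilbertBasis ι ℂ H)
    {p : ι → ℝ} (hp : Summable p) (hp0 : ∀ j, 0 ≤ p j) (hp1 : ∀ j, p j ≤ 1) :
    Δ.op = freeOperator f p ↔ ∀ s, Δ.op (occ f s) = (weight p s : ℂ) • occ f s := by
  constructor
  · intro h s
    rw [h, freeOperator_occ f hp hp0 hp1]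
  · intro h
    refine (occBasis f).ext_clm fun s => ?_
    rw [occBasis_apply, h, freeOperator_occ f hp hp0 hp1]

theorem diag_nonneg (Δ : DensityOperator (Fock H)) (ψ : Fock H) : 0 ≤ (inner ℂ ψ (Δ.op ψ)).re :=
  Δ.isPositive.re_inner_nonneg_right ψ

theorem hasSum_occ_diag (Δ : DensityOperator (Fock H)) (f : HilbertBasis ι ℂ H) :
    HasSum (fun s => (inner ℂ (occ f s) (Δ.op (occ f s))).re) 1 := by
  simpa using Δ.hasSum_diag_re (occBasis f)

variable [CompleteSpace H]

/-- The free state with occupation probabilities `p` in the basis `f`. -/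
noncomputable def freeState (f : HilbertBasis ι ℂ H) {p : ι → ℝ} (hp : Summable p)
    (hp0 : ∀ j, 0 ≤ p j) (hp1 : ∀ j, p j ≤ 1) : DensityOperator (Fock H) where
  op := freeOperator f p
  isPositive := (occBasis f).isPositive_of_eigen (weight_nonneg hp hp0 hp1)
    fun s => by rw [occBasis_apply, freeOperator_occ f hp hp0 hp1]
  posTrace_eq_one := by
    have hw := hasSum_weight hp hp0 hp1
    rw [posTrace_of_eigen (b := occBasis f) (weight_nonneg hp hp0 hp1)
      fun s => by rw [occBasis_apply, freeOperator_occ f hp hp0 hp1],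
      ← ENNReal.ofReal_tsum_of_nonneg (weight_nonneg hp hp0 hp1) hw.summable, hw.tsum_eq,
      ENNReal.ofReal_one]

theorem oneParticle_freeState (f : HilbertBasis ι ℂ H) {p : ι → ℝ} (hp : Summable p)
    (hp0 : ∀ j, 0 ≤ p j) (hp1 : ∀ j, p j ≤ 1) (j : ι) :
    oneParticle (freeState f hp hp0 hp1) (f j) = (p j : ℂ) • f j :=
  oneParticle_of_eigen (weight_nonneg hp hp0 hp1) (freeOperator_occ f hp hp0 hp1)
    (hasSum_weight_of_mem hp hp0 hp1) j

variable {Δ : DensityOperator (Fock H)} {f : HilbertBasis ι ℂ H} {p : ι → ℝ}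

theorem eigenvalue_nonneg (h : ∀ j, oneParticle Δ (f j) = (p j : ℂ) • f j) (j : ι) : 0 ≤ p j :=
  (hasSum_occupation Δ f (h j)).nonneg fun s => by split_ifs <;> simp [diag_nonneg]

theorem eigenvalue_le_one (h : ∀ j, oneParticle Δ (f j) = (p j : ℂ) • f j) (j : ι) : p j ≤ 1 :=
  hasSum_le (fun s => by split_ifs <;> simp [diag_nonneg]) (hasSum_occupation Δ f (h j))
    (hasSum_occ_diag Δ f)

theorem summable_eigenvalue (h : ∀ j, oneParticle Δ (f j) = (p j : ℂ) • f j)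
    (hΔ : meanNumber Δ < ∞) : Summable p := by
  rw [← posTrace_oneParticle, posTrace_of_eigen (b := f) (eigenvalue_nonneg h) h] at hΔ
  simpa [ENNReal.toReal_ofReal (eigenvalue_nonneg h _)] using ENNReal.summable_toReal hΔ.ne

theorem diag_eq_zero_of_weight_eq_zero (h : ∀ j, oneParticle Δ (f j) = (p j : ℂ) • f j)
    (hp : Summable p) (s : Finset ι) (hs : weight p s = 0) :
    (inner ℂ (occ f s) (Δ.op (occ f s))).re = 0 := by
  by_contra hne
  exact (weight_pos hp (siteWeight_pos_of_occupation (fun s => diag_nonneg Δ (occ f s))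
    (hasSum_occ_diag Δ f) (fun j => hasSum_occupation Δ f (h j))
    ((diag_nonneg Δ (occ f s)).lt_of_ne' hne))).ne' hs

theorem tsum_cross_eq (h : ∀ j, oneParticle Δ (f j) = (p j : ℂ) • f j) (hp : Summable p) :
    ∑' s, ENNReal.ofReal ((inner ℂ (occ f s) (Δ.op (occ f s))).re * -Real.log (weight p s))
      = occupationEntropy p :=
  tsum_cross_entropy hp (eigenvalue_nonneg h) (eigenvalue_le_one h)
    (fun s => diag_nonneg Δ (occ f s)) (hasSum_occ_diag Δ f)
    fun j => hasSum_occupation Δ f (h j)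

theorem entropy_le_occupationEntropy (h : ∀ j, oneParticle Δ (f j) = (p j : ℂ) • f j)
    (hp : Summable p) : Δ.entropy ≤ occupationEntropy p := by
  rw [← tsum_cross_eq h hp]
  simpa using Δ.entropy_le_cross (e := occBasis f)
    (weight_nonneg hp (eigenvalue_nonneg h) (eigenvalue_le_one h))
    (hasSum_weight hp (eigenvalue_nonneg h) (eigenvalue_le_one h))
    (by simpa using diag_eq_zero_of_weight_eq_zero h hp)

theorem entropy_eq_occupationEntropy_iff (h : ∀ j, oneParticle Δ (f j) = (p j : ℂ) • f j)
    (hp : Summable p) (hfin : occupationEntropy p < ∞) :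
    Δ.entropy = occupationEntropy p ↔ Δ.op = freeOperator f p := by
  have hp0 := eigenvalue_nonneg h
  have hp1 := eigenvalue_le_one h
  rw [op_eq_freeOperator_iff f hp hp0 hp1]
  constructor
  · intro heq
    have h1 := Δ.apply_eq_of_entropy_eq_cross (e := occBasis f) (weight_nonneg hp hp0 hp1)
      (hasSum_weight hp hp0 hp1) (by simpa using diag_eq_zero_of_weight_eq_zero h hp)
      (by simp only [occBasis_apply]; rw [heq, tsum_cross_eq h hp]) (heq ▸ hfin)
    simpa using h1
  · intro hΓ
    -- The entropy of the free state is its cross entropy with itself, evaluated by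
    -- `tsum_cross_entropy` with `q = weight p`.
    rw [DensityOperator.entropy_of_eigen (b := occBasis f) (weight_nonneg hp hp0 hp1)
      (by simpa using hΓ), ← tsum_cross_entropy hp hp0 hp1 (weight_nonneg hp hp0 hp1)
      (hasSum_weight hp hp0 hp1) (hasSum_weight_of_mem hp hp0 hp1)]
    simp only [Real.negMulLog, neg_mul, mul_neg]

end Fock

/-! ### Proof of the theorem -/

theorem corollary1 {H : Type u} [NormedAddCommGroup H] [InnerProductSpace ℂ H] [CompleteSpace H]
    (Δ : DensityOperator (Fock H)) (hΔ : Fock.IsFiniteState Δ) :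
    (∃ (ι : Type u) (_ : LinearOrder ι) (f : HilbertBasis ι ℂ H) (p : ι → ℝ),
      ∀ j, Fock.oneParticle Δ (f j) = (p j : ℂ) • f j) ∧
    ∀ (ι : Type v) [LinearOrder ι] (f : HilbertBasis ι ℂ H) (p : ι → ℝ),
      (∀ j, Fock.oneParticle Δ (f j) = (p j : ℂ) • f j) →
      occupationEntropy p < ⊤ →
      Δ.entropy ≤ occupationEntropy p ∧
      (Δ.entropy = occupationEntropy p ↔ Δ.op = Fock.freeOperator f p) ∧
      ∃ Γ : DensityOperator (Fock H),
        Γ.op = Fock.freeOperator f p ∧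
        Fock.IsFiniteState Γ ∧
        Fock.oneParticle Γ = Fock.oneParticle Δ ∧
        ∀ Δ' : DensityOperator (Fock H),
          Fock.oneParticle Δ' = Fock.oneParticle Δ → Δ'.entropy ≤ Γ.entropy := by
  classical
  refine ⟨?_, ?_⟩
  · obtain ⟨ι, b, l, -, hb⟩ := (Fock.isPositive_oneParticle Δ).exists_eigenbasis
      (by rw [Fock.posTrace_oneParticle]; exact hΔ.2)
    exact ⟨ι, linearOrderOfSTO WellOrderingRel, b, l, hb⟩
  intro ι _ f p h hfin
  have hp := Fock.summable_eigenvalue h hΔ.2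
  have hp0 := Fock.eigenvalue_nonneg h
  have hp1 := Fock.eigenvalue_le_one h
  have hΓ := Fock.oneParticle_freeState f hp hp0 hp1
  have hγ : Fock.oneParticle (Fock.freeState f hp hp0 hp1) = Fock.oneParticle Δ :=
    f.ext_clm fun j => by rw [hΓ, h]
  refine ⟨Fock.entropy_le_occupationEntropy h hp, Fock.entropy_eq_occupationEntropy_iff h hp hfin,
    Fock.freeState f hp hp0 hp1, rfl, ⟨?_, ?_⟩, hγ, fun Δ' hΔ' => ?_⟩
  · exact Fock.commutesWithNumber_of_eigen (Fock.freeOperator_occ f hp hp0 hp1)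
  -- The mean particle number is the trace of the one-particle operator, which the two states share.
  · rw [← Fock.posTrace_oneParticle, hγ, Fock.posTrace_oneParticle]
    exact hΔ.2
  -- The free state attains the bound that holds for every `Δ'` with this one-particle operator.
  · rw [(Fock.entropy_eq_occupationEntropy_iff hΓ hp hfin).2 rfl]
    exact Fock.entropy_le_occupationEntropy (fun j => by rw [hΔ', h]) hp
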